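/- **Setting.** Let $n,d,\tau$ be non-negative integers, $\epsilon\in(0,1/2)$, $\omega=n^{1/2-\epsilon}$, and let $G\sim G(n,1/2)$ be a random graph on $[n]=\{1,\dots,n\}$. For a pair $e$ put $G_e=1$ if $e$ is an edge of $G$ and $G_e=-1$ otherwise; for a set $W$ of pairs put $\chi_W=\prod_{e\in W}G_e$. All matrices are indexed by the subsets of $[n]$ of size at most $d$. **Ribbons.** For $I,J\subseteq[n]$ with $|I|,|J|\le d$, a (possibly improper) $(I,J)$-ribbon $R$ is a graph with vertex set $V(R)\subseteq[n]$ containing $I\cup J$ and edge set $W(R)$ (isolated vertices are allowed); $\chi_R=\chi_{W(R)}$. A set $S\subseteq V(R)$ separates $A$ from $B$ if every path from $A$ to $B$ in $R$ (including one-vertex paths) meets $S$. Among the minimum-size separators of $A$ and $B$, the leftmost one separates $A$ from all of them, and the rightmost one separates all of them from $B$; $S_L(R)$ and $S_R(R)$ denote the leftmost and rightmost one for $A=I$, $B=J$. For sets $S,T$ consider the following conditions on ribbons $R_\ell,R_m,R_r$. 1. $R_\ell$ is an $(I,S)$-ribbon with $S_L(R_\ell)=S_R(R_\ell)=S$, it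 has no edge inside $S$, and each of its vertices is in $I\cup S$ or reachable from $I$ without passing through $S$. 2. $R_r$ is a $(T,J)$-ribbon with $S_L(R_r)=S_R(R_r)=T$, it has no edge inside $T$, and each of its vertices is in $J\cup T$ or reachable from $J$ without passing through $T$. 3. $R_m$ is an $(S,T)$-ribbon with $S_L(R_m)=S$, $S_R(R_m)=T$, and every vertex outside $S\cup T$ has degree at least $1$. 4. $W(R_\ell),W(R_m),W(R_r)$ are pairwise disjoint, $V(R_\ell)\cap V(R_m)=S$, $V(R_m)\cap V(R_r)=T$, and $V(R_\ell)\cap V(R_r)=S\cap T$. Condition 3* only asks that $R_m$ be a possibly improper $(S,T)$-ribbon. **Separating factorization.** Let $R_\ell,R_m,R_r$ satisfy 1, 3*, 2 but not 4. Let $R$ be the graph with vertex set $V(R_\ell)\cup V(R_m)\cup V(R_r)$ and edge set $W(R)=W(R_\ell)\oplus W(R_m)\oplus W(R_r)$ (symmetric difference), and let $\mathfrak U$ be the set of vertices lying in at least two of $V(R_\ell),V(R_m),V(R_r)$. Let $S'$ be the leftmost minimum-size separator of $I$ from $J\cup\mathfrak U$ in $R$, and $T'$ the rightmost minimum-size separator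 of $I\cup\mathfrak U$ from $J$ in $R$. Let $V'_\ell$ (resp. $V'_r$) be the set of vertices reachable in $R$ from $I$ without passing through $S'$ (resp. from $J$ without passing through $T'$). The separating factorization consists of the $(I,S')$-ribbon $R'_\ell$ with vertex set $V'_\ell\cup S'$ and the edges $uv\in W(R)$ with $u\in V'_\ell$, $v\in V'_\ell\cup S'$; the $(T',J)$-ribbon $R'_r$ with vertex set $V'_r\cup T'$ and the edges $uv\in W(R)$ with $u\in V'_r$, $v\in V'_r\cup T'$; and the $(S',T')$-ribbon $R'_m$ with vertex set $(V(R)\setminus(V'_\ell\cup V'_r))\cup S'\cup T'$ and the remaining edges of $R$. Put $$r=\bigl(|V(R_\ell)|+|V(R_m)|+|V(R_r)|-|S|-|T|\bigr)-\bigl(|V(R'_\ell)|+|V(R'_m)|+|V(R'_r)|-|S'|-|T'|\bigr).$$ **Coefficients and matrices.** Let $c_0(R_m)=1$ if $R_m$ satisfies condition 3 and $c_0(R_m)=0$ otherwise. For $i\ge0$ and an $(S',T')$-ribbon $R'_m$ let $$c_{i+1}(R'_m)=\sum c_i(R_m)\left(\frac{\omega}{n}\right)^{r},$$ where the sum is over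 all triples $(R_\ell,R_m,R_r)$ that satisfy 1, 3*, 2 but not 4 for some $S,T$ and have separating factorization $(R'_\ell,R'_m,R'_r)$. Here $R'_\ell$ and $R'_r$ are fixed ribbons adjacent to $R'_m$ satisfying 1 and 2 (with $S',T'$ in place of $S,T$); we take the edgeless ribbons with vertex set and both ends equal to $S'$, respectively to $T'$. For $i\ge0$ let $Q_i$ be the matrix $$Q_i(S,T)=\sum_{\substack{R\ \text{a possibly improper } (S,T)\text{-ribbon}\\ |V(R)|\le\tau}}c_i(R)\left(\frac{\omega}{n}\right)^{|V(R)|-\frac{|S|+|T|}2}\chi_R .$$ In particular, $Q_0$ is the corresponding sum, with coefficients $1$, over the ribbons that satisfy condition 3. Let $D$ be the diagonal matrix with $D(S,S)=2^{\binom{|S|}2}/4$ if $S$ is a clique in $G$ and $D(S,S)=0$ otherwise (the empty set and singletons are cliques). **Statement.** There are a constant $C>0$, a constant $K$ and an $n_0$ such that, for all $n\ge n_0$ and all $\epsilon\in(0,1/2)$ and $d,\tau\in\mathbb N$ with $$\epsilon\ \ge\ C\,\frac{\log\log n}{\log n},\qquad \frac{Cd}{\epsilon}\ \le\ \tau\ \le\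 \frac{\epsilon}{C}\log n,$$ with probability at least $1-K/n^{10\log n}$ over $G\sim G(n,1/2)$ one has $$Q_0\succeq D\qquad\text{and}\qquad -\frac{D}{8d}\ \preceq\ Q_i\ \preceq\ \frac{D}{8d}\quad\text{for every } 1\le i\le 2d .$$ -/

import Mathlib

namespace PlantedClique

/-- A ribbon on the vertex set `[n] = Fin n`: a graph with vertex set `verts` and edge set `edges`,
together with two (possibly intersecting) ends `left` and `right`, each of size at most `d`, that are
contained in the vertex set. Isolated vertices outside the two ends are allowed, so this is the
notion of a *possibly improper* ribbon: the set of its isolated vertices outside the ends is the set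
written `Z(R)`, and the ribbon is proper when that set is empty. -/
@[ext]
structure Ribbon (n d : ℕ) where
  left : Finset (Fin n)
  right : Finset (Fin n)
  verts : Finset (Fin n)
  edges : Finset (Sym2 (Fin n))
  left_subset : left ⊆ verts
  right_subset : right ⊆ verts
  card_left : left.card ≤ d
  card_right : right.card ≤ d
  not_isDiag : ∀ e ∈ edges, ¬ e.IsDiag
  mem_verts : ∀ e ∈ edges, ∀ v ∈ e, v ∈ verts

noncomputable instance (n d : ℕ) : Fintype (Ribbon n d) :=
  Fintype.ofInjective (fun R => (R.left, R.right, R.verts, R.edges)) (by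
    intro R R' h
    simp only [Prod.mk.injEq] at h
    exact Ribbon.ext h.1 h.2.1 h.2.2.1 h.2.2.2)

section Separators

variable {n : ℕ}

/-- The simple graph on `[n]` with edge set `W`. -/
def edgeGraph (W : Finset (Sym2 (Fin n))) : SimpleGraph (Fin n) :=
  SimpleGraph.fromEdgeSet (W : Set (Sym2 (Fin n)))

/-- `S` separates `A` from `B` in the graph with edge set `W`: every walk from `A` to `B`
(including the walks of length zero, at the vertices of `A ∩ B`) meets `S`. -/
def Separates (W : Finset (Sym2 (Fin n))) (A B S : Finset (Fin n)) : Prop :=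
  ∀ a ∈ A, ∀ b ∈ B, ∀ p : (edgeGraph W).Walk a b, ∃ v ∈ p.support, v ∈ S

/-- `S` is a minimum-size separator of `A` and `B` in the graph with vertex set `V` and
edge set `W`. -/
def IsMinSep (V : Finset (Fin n)) (W : Finset (Sym2 (Fin n))) (A B S : Finset (Fin n)) : Prop :=
  S ⊆ V ∧ Separates W A B S ∧ ∀ Q : Finset (Fin n), Q ⊆ V → Separates W A B Q → S.card ≤ Q.card

/-- `S` is the leftmost minimum-size separator: it separates `A` from every
minimum-size separator of `A` and `B`. -/
def IsLeftmostSep (V : Finset (Fin n)) (W : Finset (Sym2 (Fin n))) (A B S : Finset (Fin n)) :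
    Prop :=
  IsMinSep V W A B S ∧ ∀ Q : Finset (Fin n), IsMinSep V W A B Q → Separates W A Q S

/-- `S` is the rightmost minimum-size separator: it separates every
minimum-size separator of `A` and `B` from `B`. -/
def IsRightmostSep (V : Finset (Fin n)) (W : Finset (Sym2 (Fin n))) (A B S : Finset (Fin n)) :
    Prop :=
  IsMinSep V W A B S ∧ ∀ Q : Finset (Fin n), IsMinSep V W A B Q → Separates W Q B S

open Classical in
/-- The set of vertices reachable from `A`, in the graph with edge set `W`, without passing
through `S`. -/
noncomputable def reach (W : Finset (Sym2 (Fin n))) (A S : Finset (Fin n)) : Finset (Fin n) :=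
  Finset.univ.filter fun v => ∃ a ∈ A, ∃ p : (edgeGraph W).Walk a v, ∀ u ∈ p.support, u ∉ S

end Separators

section Factorization

variable {n d : ℕ}

/-- Condition on a left factor: an `(I, S)`-ribbon whose leftmost and rightmost minimum separators
are both `S`, all of whose vertices are in `I`, in `S`, or reachable from `I` without passing
through `S`, and which has no edges inside `S`. -/
def IsLeftFactor (R : Ribbon n d) : Prop :=
  IsLeftmostSep R.verts R.edges R.left R.right R.right ∧
  IsRightmostSep R.verts R.edges R.left R.right R.right ∧
  (∀ v ∈ R.verts, v ∈ R.left ∨ v ∈ R.right ∨ v ∈ reach R.edges R.left R.right) ∧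
  ∀ e ∈ R.edges, ∃ v ∈ e, v ∉ R.right

/-- Condition on a right factor: an `(S, J)`-ribbon whose leftmost and rightmost minimum separators
are both `S`, all of whose vertices are in `J`, in `S`, or reachable from `J` without passing
through `S`, and which has no edges inside `S`. -/
def IsRightFactor (R : Ribbon n d) : Prop :=
  IsLeftmostSep R.verts R.edges R.left R.right R.left ∧
  IsRightmostSep R.verts R.edges R.left R.right R.left ∧
  (∀ v ∈ R.verts, v ∈ R.right ∨ v ∈ R.left ∨ v ∈ reach R.edges R.right R.left) ∧
  ∀ e ∈ R.edges, ∃ v ∈ e, v ∉ R.left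

/-- Condition on a middle factor: an `(S, T)`-ribbon whose leftmost minimum separator is `S`, whose
rightmost minimum separator is `T`, and in which every vertex outside `S ∪ T` has degree at
least one. -/
def IsMiddleFactor (R : Ribbon n d) : Prop :=
  IsLeftmostSep R.verts R.edges R.left R.right R.left ∧
  IsRightmostSep R.verts R.edges R.left R.right R.right ∧
  ∀ v ∈ R.verts, v ∉ R.left → v ∉ R.right → ∃ e ∈ R.edges, v ∈ e

/-- The triple consists of an `(I, S)`-, an `(S, T)`- and a `(T, J)`-ribbon for some `S`, `T`. -/
def Composable (R₀ R₁ R₂ : Ribbon n d) : Prop :=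
  R₀.right = R₁.left ∧ R₁.right = R₂.left

/-- Disjointness condition for a composable triple: the edge sets are pairwise disjoint, and the
vertex sets intersect only in the separators `S = R₁.left` and `T = R₁.right`. -/
def DisjointFactors (R₀ R₁ R₂ : Ribbon n d) : Prop :=
  (Disjoint R₀.edges R₁.edges ∧ Disjoint R₁.edges R₂.edges ∧ Disjoint R₀.edges R₂.edges) ∧
  R₀.verts ∩ R₁.verts = R₁.left ∧
  R₁.verts ∩ R₂.verts = R₁.right ∧
  R₀.verts ∩ R₂.verts = R₁.left ∩ R₁.right

/-- The vertex set of the product of three ribbons. -/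
def prodVerts (R₀ R₁ R₂ : Ribbon n d) : Finset (Fin n) :=
  R₀.verts ∪ R₁.verts ∪ R₂.verts

/-- The edge set of the product of three ribbons: the symmetric difference of the edge sets. -/
def prodEdges (R₀ R₁ R₂ : Ribbon n d) : Finset (Sym2 (Fin n)) :=
  symmDiff (symmDiff R₀.edges R₁.edges) R₂.edges

/-- The vertices that appear in more than one of the three ribbons. -/
def repeatedVerts (R₀ R₁ R₂ : Ribbon n d) : Finset (Fin n) :=
  (R₀.verts ∩ R₁.verts) ∪ (R₀.verts ∩ R₂.verts) ∪ (R₁.verts ∩ R₂.verts)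

open Classical in
/-- `(L', M', R')` is the separating factorization of `(L, M, R)`. Here `I = L.left` and
`J = R.right`, the separators are `S' = L'.right` and `T' = R'.left`, and the product of
`(L, M, R)` is the graph that is factored again. -/
structure IsSeparatingFactorization (L M R L' M' R' : Ribbon n d) : Prop where
  left_eq : L'.left = L.left
  right_eq : R'.right = R.right
  composable : Composable L' M' R'
  /-- `S'` is the leftmost minimum separator of `I` from `J` and the repeated vertices. -/
  leftmost : IsLeftmostSep (prodVerts L M R) (prodEdges L M R)
    L.left (R.right ∪ repeatedVerts L M R) L'.right
  /-- `T'` is the rightmost minimum separator of `J` from `I` and the repeated vertices. -/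
  rightmost : IsRightmostSep (prodVerts L M R) (prodEdges L M R)
    (L.left ∪ repeatedVerts L M R) R.right R'.left
  left_verts : L'.verts = reach (prodEdges L M R) L.left L'.right ∪ L'.right
  right_verts : R'.verts = reach (prodEdges L M R) R.right R'.left ∪ R'.left
  middle_verts : M'.verts =
    (prodVerts L M R \ (reach (prodEdges L M R) L.left L'.right ∪
      reach (prodEdges L M R) R.right R'.left)) ∪ L'.right ∪ R'.left
  left_edges : L'.edges = (prodEdges L M R).filter fun e =>
    ∃ u v, e = s(u, v) ∧ u ∈ reach (prodEdges L M R) L.left L'.right ∧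
      v ∈ reach (prodEdges L M R) L.left L'.right ∪ L'.right
  right_edges : R'.edges = (prodEdges L M R).filter fun e =>
    ∃ u v, e = s(u, v) ∧ u ∈ reach (prodEdges L M R) R.right R'.left ∧
      v ∈ reach (prodEdges L M R) R.right R'.left ∪ R'.left
  middle_edges : M'.edges = prodEdges L M R \ (L'.edges ∪ R'.edges)

/-- `|V(L)| + |V(M)| + |V(R)| - |S| - |T|` for a composable triple with separators
`S = M.left`, `T = M.right`. -/
def tripleSize (L M R : Ribbon n d) : ℤ :=
  (L.verts.card : ℤ) + M.verts.card + R.verts.card - M.left.card - M.right.card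

open Classical in
/-- One step of the recursion for the coefficients. The sum runs over all triples `(L, M, R)` of a
left factor, a possibly improper middle ribbon and a right factor that violate the disjointness
condition and have `(L', M', R')` as their separating factorization; the term of a triple is
`c(M) * q ^ r`, where `r` is the number of intersections. -/
noncomputable def nextCoeffSum (q : ℝ) (c : Ribbon n d → ℝ) (L' M' R' : Ribbon n d) : ℝ :=
  ∑ L : Ribbon n d, ∑ M : Ribbon n d, ∑ R : Ribbon n d,
    if Composable L M R ∧ IsLeftFactor L ∧ IsRightFactor R ∧ ¬ DisjointFactors L M R ∧
        IsSeparatingFactorization L M R L' M' R'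
    then c M * q ^ (tripleSize L M R - tripleSize L' M' R')
    else 0

/-- The ribbon with vertex set `S`, both ends equal to `S`, and no edges. It is both a left factor
and a right factor. -/
def trivialRibbon (S : Finset (Fin n)) (hS : S.card ≤ d) : Ribbon n d where
  left := S
  right := S
  verts := S
  edges := ∅
  left_subset := Finset.Subset.refl S
  right_subset := Finset.Subset.refl S
  card_left := hS
  card_right := hS
  not_isDiag := by simp
  mem_verts := by simp

open Classical in
/-- The coefficient functions `c₀, c₁, c₂, …` on possibly improper ribbons. `c₀` is the indicator of
the middle factors, and `cᵢ₊₁(M')` is the recursion sum for `cᵢ` at `(L', M', R')`, where the choice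
of the left and right factors `L'`, `R'` adjacent to `M'` does not matter; they are taken to be the
trivial ribbons at the two ends of `M'`. -/
noncomputable def coeff (q : ℝ) : ℕ → Ribbon n d → ℝ
  | 0 => fun M' => if IsMiddleFactor M' then 1 else 0
  | i + 1 => fun M' => nextCoeffSum q (coeff q i)
      (trivialRibbon M'.left M'.card_left) M' (trivialRibbon M'.right M'.card_right)

end Factorization

section Matrices

variable {n d : ℕ}

open Classical in
/-- The character `χ_R(G)`: the product of the `±1` edge indicators of `G` over the edges of `R`. -/
noncomputable def chi (R : Ribbon n d) (G : SimpleGraph (Fin n)) : ℝ :=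
  ∏ e ∈ R.edges, if e ∈ G.edgeSet then 1 else -1

/-- The index set of the matrices: subsets of `[n]` of size at most `d`. -/
abbrev SmallSet (n d : ℕ) : Type := {S : Finset (Fin n) // S.card ≤ d}

open Classical in
/-- The matrix `Q_c(S, T) = ∑ c(R) q ^ (|V(R)| - (|S| + |T|) / 2) χ_R(G)`, the sum being over all
possibly improper `(S, T)`-ribbons `R` with at most `τ` vertices. -/
noncomputable def qMatrix (q : ℝ) (τ : ℕ) (G : SimpleGraph (Fin n)) (c : Ribbon n d → ℝ) :
    Matrix (SmallSet n d) (SmallSet n d) ℝ :=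
  Matrix.of fun S T => ∑ R : Ribbon n d,
    if R.left = S.1 ∧ R.right = T.1 ∧ R.verts.card ≤ τ
    then c R * q ^ ((R.verts.card : ℝ) - ((S.1.card : ℝ) + (T.1.card : ℝ)) / 2) * chi R G
    else 0

/-- The matrix `Qᵢ` of the factorization. For `i = 0` it is the sum over the middle factors with at
most `τ` vertices. -/
noncomputable def Q (d : ℕ) (q : ℝ) (τ : ℕ) (G : SimpleGraph (Fin n)) (i : ℕ) :
    Matrix (SmallSet n d) (SmallSet n d) ℝ :=
  qMatrix q τ G (coeff q i)

open Classical in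
/-- The diagonal matrix with entry `2 ^ (|S| choose 2) / 4` at the cliques `S` of `G` and `0` at the
other sets. -/
noncomputable def D (d : ℕ) (G : SimpleGraph (Fin n)) :
    Matrix (SmallSet n d) (SmallSet n d) ℝ :=
  Matrix.diagonal fun S => if G.IsClique (S.1 : Set (Fin n)) then 2 ^ (S.1.card.choose 2) / 4 else 0

/-- The ratio `ω / n`, where `ω = n ^ (1 / 2 - ε)` is the size of the planted clique. -/
noncomputable def cliqueRatio (n : ℕ) (ε : ℝ) : ℝ := (n : ℝ) ^ (1 / 2 - ε) / n

/-- The law of the random graph `G(n, 1 / 2)`. -/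
noncomputable def halfGraph (n : ℕ) : MeasureTheory.Measure (SimpleGraph (Fin n)) :=
  SimpleGraph.binomialRandom (Fin n) ⟨1 / 2, by norm_num, by norm_num⟩

end Matrices

end PlantedClique

/-!
The matrices are compared with the diagonal matrix `D` after a normalisation, and the normalised
matrices are bounded by the trace method. Throughout, `v`, `z` and `p` denote the numbers of
vertices of a ribbon, of its isolated vertices outside the ends, and the size of a minimum
separator of the ends; `s` and `t` are the sizes of the ends.

**Coefficients.** With the trivial ribbons as outer factors, the separating factorization of a
triple has the whole product as its middle factor, and the condition says that the two ends of the
product are themselves minimum separators of the ends from the repeated vertices (`isStep_iff`). A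
minimum separator of the product can be turned into separators in the three factors. Comparing
sizes vertex by vertex gives the intersection trade-off (`IsStep.tradeoff`): in a step of the
recursion, the defect `s + t + 2 z - 2 p` grows by at most twice the number of intersections. As
each intersection contributes a factor `ω / n = n ^ (-1/2 - ε)`, and as there is at least one, the
coefficients satisfy `|cᵢ(R)| ≤ n ^ (-defect / 4 - ε i / 2)` up to a factor exponential in `τ (2 v
- s - t)`, which absorbs the number of triples (`abs_coeff_le`).

**Normalisation.** Pairs of vertices inside an end of a ribbon can be added to or removed from its
edges without changing the coefficients (`coeff_toggle`). The sum of the characters of all edge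
sets inside the two ends `S` and `T` is a power of `2` times the indicator that both are cliques.
So `Qᵢ = D ^ (1/2) * Nᵢ * D ^ (1/2)` (`Q_eq_diagonal_mul`), where `Nᵢ` is a sum over the clean
ribbons, which have no edges inside the ends. The ribbons of `N₀` with `S = T = V(R)` contribute
`4` times the identity. It remains to show that `N₀ - 4` and the other `Nᵢ` have norm at most `1 /
(8 d)`.

**Trace method.** The expected trace of `Nᵢ ^ k` is a sum over closed chains of `k` ribbons in
which every pair of vertices is an edge an even number of times. In such a chain, a ribbon has no
edge between a vertex that occurs for the first time and one that occurs for the last time, so the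
vertices that are neither separate its ends, and those that are both are isolated. Hence the
number of vertices of the chain is at most the sum of `(v + z - p) / 2` over its ribbons, up to an
additive `2 τ` (`two_mul_card_support_le`). This reduces the expected trace to the row sums of the
absolute values of the coefficients of `Nᵢ`, times `n ^ ((v + z - p) / 2)`, over the ribbons
inside a set of at most `k τ` vertices (`sum_trace_ribbonMatrix_le`). Now `(v + z - p) / 2` is the
sum of a quarter of the defect, which is compensated by the bound on `cᵢ`, and of half of `v - (s
+ t) / 2`, which is compensated by the power of `ω / n` in the definition of `Qᵢ`. What is left of
these two bounds makes the row sums at most `n ^ (-ε / 4)` times a factor exponential in `τ`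
(`normWeight_properCoeff_le`, `row_sum_le`). Markov's inequality for `k` of order `(log n) ^ 2`
finishes the proof.
-/

namespace PlantedClique

/-! ### Reachability and separators -/

section Separation

variable {n : ℕ} {V W W' A B S : Finset (Fin n)} {E E' : Finset (Sym2 (Fin n))} {u v : Fin n}

lemma edgeGraph_adj : (edgeGraph E).Adj u v ↔ s(u, v) ∈ E ∧ u ≠ v := by
  simp [edgeGraph]

lemma mem_reach_of_mem (hv : v ∈ A) (hS : v ∉ S) : v ∈ reach E A S := by
  simp only [reach, Finset.mem_filter, Finset.mem_univ, true_and]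
  exact ⟨v, hv, .nil, by simpa using hS⟩

lemma notMem_of_mem_reach (hv : v ∈ reach E A S) : v ∉ S := by
  simp only [reach, Finset.mem_filter, Finset.mem_univ, true_and] at hv
  obtain ⟨a, -, p, hp⟩ := hv
  exact hp v p.end_mem_support

lemma mem_reach_of_edge (hu : u ∈ reach E A S) (he : s(u, v) ∈ E) (hv : v ∉ S) :
    v ∈ reach E A S := by
  by_cases huv : u = v
  · exact huv ▸ hu
  simp only [reach, Finset.mem_filter, Finset.mem_univ, true_and] at hu ⊢
  obtain ⟨a, ha, p, hp⟩ := hu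
  refine ⟨a, ha, p.concat (edgeGraph_adj.2 ⟨he, huv⟩), fun w hw => ?_⟩
  rw [SimpleGraph.Walk.support_concat, List.mem_append] at hw
  rcases hw with hw | hw
  · exact hp w hw
  · rw [List.mem_singleton] at hw
    exact hw ▸ hv

/-- The reachable set is the least set that contains `A \ S` and is closed under the edges that
avoid `S`. -/
lemma reach_induction {P : Fin n → Prop} (base : ∀ a ∈ A, a ∉ S → P a)
    (step : ∀ u v, P u → u ∉ S → s(u, v) ∈ E → v ∉ S → P v) :
    ∀ v ∈ reach E A S, P v := by
  intro v hv
  simp only [reach, Finset.mem_filter, Finset.mem_univ, true_and] at hv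
  obtain ⟨a, ha, p, hp⟩ := hv
  have key : ∀ {x y : Fin n} (p : (edgeGraph E).Walk x y), (∀ u ∈ p.support, u ∉ S) → P x → P y := by
    intro x y p
    induction p with
    | nil => exact fun _ h => h
    | cons h p ih =>
      intro hp hx
      refine ih (fun u hu => hp u (by simp [hu])) ?_
      exact step _ _ hx (hp _ (by simp)) (edgeGraph_adj.1 h).1 (hp _ (by simp))
  exact key p hp (base a ha (hp a p.start_mem_support))

lemma separates_iff : Separates E A B S ↔ ∀ v ∈ reach E A S, v ∉ B := by
  simp only [Separates, reach, Finset.mem_filter, Finset.mem_univ, true_and]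
  constructor
  · rintro h v ⟨a, ha, p, hp⟩ hv
    obtain ⟨u, hu, hus⟩ := h a ha v hv p
    exact hp u hu hus
  · intro h a ha b hb p
    by_contra! hp
    exact h b ⟨a, ha, p, hp⟩ hb

/-- To show that `S` separates `A` from `B`, it suffices to give a set, described by the predicate
`P`, that contains `A \ S`, is closed under the edges that avoid `S`, and misses `B`. -/
lemma separates_of_closed (P : Fin n → Prop) (base : ∀ a ∈ A, a ∉ S → P a)
    (step : ∀ u v, P u → u ∉ S → s(u, v) ∈ E → v ∉ S → P v)
    (hB : ∀ b ∈ B, b ∉ S → ¬ P b) : Separates E A B S :=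
  separates_iff.2 fun v hv hvB =>
    hB v hvB (notMem_of_mem_reach hv) (reach_induction base step v hv)

lemma Separates.symm (h : Separates E A B S) : Separates E B A S := by
  intro b hb a ha p
  obtain ⟨v, hv, hvS⟩ := h a ha b hb p.reverse
  exact ⟨v, by simpa using hv, hvS⟩

lemma separates_comm : Separates E A B S ↔ Separates E B A S :=
  ⟨Separates.symm, Separates.symm⟩

lemma separates_left : Separates E A B A := fun a ha _ _ p => ⟨a, p.start_mem_support, ha⟩

lemma separates_right : Separates E A B B := fun _ _ b hb p => ⟨b, p.end_mem_support, hb⟩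

lemma reach_self : reach E A A = ∅ := by
  rw [Finset.eq_empty_iff_forall_notMem]
  refine fun v hv => reach_induction (P := fun _ => False) (fun a ha h => h ha) ?_ v hv
  exact fun _ _ h => h.elim

/-- Edges inside the source set do not matter for reachability. -/
lemma reach_congr (h : ∀ e, ¬ (∀ x ∈ e, x ∈ A) → (e ∈ E ↔ e ∈ E')) :
    reach E A S = reach E' A S := by
  have aux : ∀ {E E' : Finset (Sym2 (Fin n))},
      (∀ e, ¬ (∀ x ∈ e, x ∈ A) → (e ∈ E ↔ e ∈ E')) → reach E A S ⊆ reach E' A S := by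
    intro E E' h v hv
    refine reach_induction (P := fun v => v ∈ reach E' A S)
      (fun a ha hS => mem_reach_of_mem ha hS) (fun u v hu _ he hv => ?_) v hv
    by_cases hin : ∀ x ∈ s(u, v), x ∈ A
    · exact mem_reach_of_mem (hin v (by simp)) hv
    · exact mem_reach_of_edge hu ((h _ hin).1 he) hv
  exact (aux h).antisymm (aux fun e he => (h e he).symm)

lemma separates_congr (h : ∀ e, ¬ (∀ x ∈ e, x ∈ A) → (e ∈ E ↔ e ∈ E')) :
    Separates E A B S ↔ Separates E' A B S := by
  rw [separates_iff, separates_iff, reach_congr h]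

lemma isMinSep_comm : IsMinSep V E A B S ↔ IsMinSep V E B A S := by
  simp only [IsMinSep, separates_comm (A := A) (B := B)]

lemma isMinSep_congr (h : ∀ e, ¬ (∀ x ∈ e, x ∈ A) → (e ∈ E ↔ e ∈ E')) :
    IsMinSep V E A B S ↔ IsMinSep V E' A B S := by
  simp only [IsMinSep, separates_congr h]

lemma isLeftmostSep_comm : IsLeftmostSep V E A B S ↔ IsRightmostSep V E B A S := by
  simp only [IsLeftmostSep, IsRightmostSep, isMinSep_comm (A := A) (B := B),
    separates_comm (A := A)]

lemma isLeftmostSep_congr (h : ∀ e, ¬ (∀ x ∈ e, x ∈ A) → (e ∈ E ↔ e ∈ E')) :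
    IsLeftmostSep V E A B S ↔ IsLeftmostSep V E' A B S := by
  simp only [IsLeftmostSep, isMinSep_congr h, separates_congr h]

lemma isLeftmostSep_left_iff : IsLeftmostSep V E A B A ↔ IsMinSep V E A B A :=
  ⟨fun h => h.1, fun h => ⟨h, fun _ _ => separates_left⟩⟩

lemma isRightmostSep_right_iff : IsRightmostSep V E A B B ↔ IsMinSep V E A B B :=
  ⟨fun h => h.1, fun h => ⟨h, fun _ _ => separates_right⟩⟩

/-- The minimum size of a separator of `A` and `B` inside `V`. -/
noncomputable def sepNum (V : Finset (Fin n)) (E : Finset (Sym2 (Fin n))) (A B : Finset (Fin n)) :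
    ℕ :=
  sInf {k | ∃ Q ⊆ V, Separates E A B Q ∧ Q.card = k}

lemma sepNum_le {Q : Finset (Fin n)} (hQ : Q ⊆ V) (h : Separates E A B Q) :
    sepNum V E A B ≤ Q.card :=
  Nat.sInf_le ⟨Q, hQ, h, rfl⟩

lemma exists_card_eq_sepNum (hA : A ⊆ V) :
    ∃ Q ⊆ V, Separates E A B Q ∧ Q.card = sepNum V E A B :=
  Nat.sInf_mem (s := {k | ∃ Q ⊆ V, Separates E A B Q ∧ Q.card = k})
    ⟨_, A, hA, separates_left, rfl⟩

lemma IsMinSep.card_eq (h : IsMinSep V E A B S) : S.card = sepNum V E A B := by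
  refine le_antisymm ?_ (sepNum_le h.1 h.2.1)
  obtain ⟨Q, hQ, hsep, hc⟩ : ∃ Q ⊆ V, Separates E A B Q ∧ Q.card = sepNum V E A B :=
    Nat.sInf_mem (s := {k | ∃ Q ⊆ V, Separates E A B Q ∧ Q.card = k}) ⟨_, S, h.1, h.2.1, rfl⟩
  exact hc ▸ h.2.2 Q hQ hsep

end Separation

/-! ### The recursion for the coefficients, and its symmetries -/

section Recursion

variable {n d : ℕ}

/-- `(L, M, R)` contributes to the recursion sum of the middle ribbon `M'`: this is the separating
factorization condition with the trivial ribbons on both sides of `M'`, in simplified form. -/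
structure IsStep (L M R M' : Ribbon n d) : Prop where
  composable : Composable L M R
  leftFactor : IsLeftFactor L
  rightFactor : IsRightFactor R
  not_disjoint : ¬ DisjointFactors L M R
  left_eq : L.left = M'.left
  right_eq : R.right = M'.right
  minSep_left : IsMinSep (prodVerts L M R) (prodEdges L M R) L.left
    (R.right ∪ repeatedVerts L M R) L.left
  minSep_right : IsMinSep (prodVerts L M R) (prodEdges L M R)
    (L.left ∪ repeatedVerts L M R) R.right R.right
  verts_eq : M'.verts = prodVerts L M R
  edges_eq : M'.edges = prodEdges L M R

/-- The number of intersections of a triple `(L, M, R)` with product `M'`: the exponent of `ω / n`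
in the recursion. It is an integer here, and shown to be positive in `IsStep.one_le_excess`. -/
def excess (L M R M' : Ribbon n d) : ℤ :=
  (L.verts.card : ℤ) + M.verts.card + R.verts.card - M.left.card - M.right.card - M'.verts.card

/-- If the outer factors of the separating factorization are trivial, then its separators are the
ends of the product, the sets reachable from the ends are empty, and the middle factor is the whole
product. -/
lemma isStep_iff (L M R M' : Ribbon n d) :
    (Composable L M R ∧ IsLeftFactor L ∧ IsRightFactor R ∧ ¬ DisjointFactors L M R ∧
      IsSeparatingFactorization L M R (trivialRibbon M'.left M'.card_left) M'
        (trivialRibbon M'.right M'.card_right)) ↔ IsStep L M R M' := by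
  constructor
  · rintro ⟨h1, h2, h3, h4, h5⟩
    have hl : M'.left = L.left := h5.left_eq
    have hr : M'.right = R.right := h5.right_eq
    have a1 := h5.leftmost.1
    have a2 := h5.rightmost.1
    have hv := h5.middle_verts
    have he := h5.middle_edges
    simp only [trivialRibbon] at a1 a2 hv he
    rw [hl] at a1 hv
    rw [hr] at a2 hv
    refine ⟨h1, h2, h3, h4, hl.symm, hr.symm, a1, a2, ?_, ?_⟩
    · rw [hv, reach_self, reach_self]
      ext v
      have b1 : v ∈ L.left → v ∈ L.verts := fun h => L.left_subset h
      have b2 : v ∈ R.right → v ∈ R.verts := fun h => R.right_subset h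
      simp only [prodVerts, Finset.mem_union, Finset.mem_sdiff, Finset.notMem_empty, or_self,
        not_false_eq_true, and_true]
      grind
    · rw [he]; simp
  · intro h
    refine ⟨h.composable, h.leftFactor, h.rightFactor, h.not_disjoint, ?_⟩
    have hl := h.left_eq
    have hr := h.right_eq
    refine ⟨hl.symm, hr.symm, ⟨rfl, rfl⟩, ?_, ?_, ?_, ?_, ?_, ?_, ?_, ?_⟩
    · simp only [trivialRibbon]
      rw [← hl]
      exact isLeftmostSep_left_iff.2 h.minSep_left
    · simp only [trivialRibbon]
      rw [← hr]
      exact isRightmostSep_right_iff.2 h.minSep_right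
    · simp [trivialRibbon, hl, reach_self]
    · simp [trivialRibbon, hr, reach_self]
    · simp only [trivialRibbon]
      rw [← hl, ← hr, reach_self, reach_self, h.verts_eq]
      ext v
      have b1 : v ∈ L.left → v ∈ L.verts := fun h => L.left_subset h
      have b2 : v ∈ R.right → v ∈ R.verts := fun h => R.right_subset h
      simp only [prodVerts, Finset.mem_union, Finset.mem_sdiff, Finset.notMem_empty, or_self,
        not_false_eq_true, and_true]
      grind
    · simp [trivialRibbon, hl, reach_self]
    · simp [trivialRibbon, hr, reach_self]
    · simp [trivialRibbon, h.edges_eq]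

open Classical in
lemma coeff_succ (q : ℝ) (i : ℕ) (M' : Ribbon n d) :
    coeff q (i + 1) M' = ∑ L : Ribbon n d, ∑ M : Ribbon n d, ∑ R : Ribbon n d,
      if IsStep L M R M' then coeff q i M * q ^ excess L M R M' else 0 := by
  simp only [coeff, nextCoeffSum]
  refine Finset.sum_congr rfl fun L _ => Finset.sum_congr rfl fun M _ =>
    Finset.sum_congr rfl fun R _ => ?_
  by_cases h : IsStep L M R M'
  · rw [if_pos h, if_pos ((isStep_iff L M R M').2 h)]
    congr 2
    simp only [excess, tripleSize, trivialRibbon]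
    ring
  · rw [if_neg h, if_neg (fun h' => h ((isStep_iff L M R M').1 h'))]

/-- The ribbon with the two ends exchanged. -/
def Ribbon.flip (R : Ribbon n d) : Ribbon n d where
  left := R.right
  right := R.left
  verts := R.verts
  edges := R.edges
  left_subset := R.right_subset
  right_subset := R.left_subset
  card_left := R.card_right
  card_right := R.card_left
  not_isDiag := R.not_isDiag
  mem_verts := R.mem_verts

/-- Exchanging the ends, as an involution of the set of ribbons. -/
def flipEquiv (n d : ℕ) : Ribbon n d ≃ Ribbon n d :=
  ⟨Ribbon.flip, Ribbon.flip, fun _ => rfl, fun _ => rfl⟩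

lemma isLeftFactor_flip {R : Ribbon n d} (h : IsRightFactor R) : IsLeftFactor R.flip :=
  ⟨isLeftmostSep_comm.2 h.2.1, isLeftmostSep_comm.1 h.1, h.2.2⟩

lemma isRightFactor_flip {R : Ribbon n d} (h : IsLeftFactor R) : IsRightFactor R.flip :=
  ⟨isLeftmostSep_comm.2 h.2.1, isLeftmostSep_comm.1 h.1, h.2.2⟩

lemma isMiddleFactor_flip {R : Ribbon n d} (h : IsMiddleFactor R) : IsMiddleFactor R.flip :=
  ⟨isLeftmostSep_comm.2 h.2.1, isLeftmostSep_comm.1 h.1, fun v hv h1 h2 => h.2.2 v hv h2 h1⟩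

lemma prodVerts_flip (L M R : Ribbon n d) : prodVerts R.flip M.flip L.flip = prodVerts L M R := by
  ext v; simp only [prodVerts, Ribbon.flip, Finset.mem_union]; tauto

lemma prodEdges_flip (L M R : Ribbon n d) : prodEdges R.flip M.flip L.flip = prodEdges L M R := by
  ext v; simp only [prodEdges, Ribbon.flip, Finset.mem_symmDiff]; tauto

lemma repeatedVerts_flip (L M R : Ribbon n d) :
    repeatedVerts R.flip M.flip L.flip = repeatedVerts L M R := by
  ext v; simp only [repeatedVerts, Ribbon.flip, Finset.mem_union, Finset.mem_inter]; tauto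

lemma DisjointFactors.flip {L M R : Ribbon n d} (h : DisjointFactors L M R) :
    DisjointFactors R.flip M.flip L.flip := by
  obtain ⟨⟨h1, h2, h3⟩, h4, h5, h6⟩ := h
  refine ⟨⟨h2.symm, h1.symm, h3.symm⟩, ?_, ?_, ?_⟩
  · exact (Finset.inter_comm _ _).trans h5
  · exact (Finset.inter_comm _ _).trans h4
  · exact (Finset.inter_comm _ _).trans (h6.trans (Finset.inter_comm _ _))

lemma IsStep.flip {L M R M' : Ribbon n d} (h : IsStep L M R M') :
    IsStep R.flip M.flip L.flip M'.flip := by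
  refine ⟨⟨h.composable.2.symm, h.composable.1.symm⟩, isLeftFactor_flip h.rightFactor,
    isRightFactor_flip h.leftFactor, fun h' => h.not_disjoint h'.flip, h.right_eq, h.left_eq,
    ?_, ?_, ?_, ?_⟩
  · rw [prodVerts_flip, prodEdges_flip, repeatedVerts_flip]
    exact isMinSep_comm.1 h.minSep_right
  · rw [prodVerts_flip, prodEdges_flip, repeatedVerts_flip]
    exact isMinSep_comm.1 h.minSep_left
  · rw [prodVerts_flip]; exact h.verts_eq
  · rw [prodEdges_flip]; exact h.edges_eq

lemma isStep_flip_iff {L M R M' : Ribbon n d} :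
    IsStep R.flip M.flip L.flip M'.flip ↔ IsStep L M R M' :=
  ⟨fun h => h.flip, fun h => h.flip⟩

/-- The involution that reverses the order of a triple and exchanges the ends of its members. -/
lemma sum_flip (f : Ribbon n d → Ribbon n d → Ribbon n d → ℝ) :
    ∑ L, ∑ M, ∑ R, f L M R = ∑ L, ∑ M, ∑ R, f (Ribbon.flip R) (Ribbon.flip M) (Ribbon.flip L) := by
  calc ∑ L, ∑ M, ∑ R, f L M R
      = ∑ R, ∑ M, ∑ L, f (Ribbon.flip R) (Ribbon.flip M) (Ribbon.flip L) := by
        rw [← (flipEquiv n d).sum_comp]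
        refine Finset.sum_congr rfl fun R _ => ?_
        rw [← (flipEquiv n d).sum_comp]
        refine Finset.sum_congr rfl fun M _ => ?_
        rw [← (flipEquiv n d).sum_comp]
        rfl
    _ = ∑ R, ∑ L, ∑ M, f (Ribbon.flip R) (Ribbon.flip M) (Ribbon.flip L) :=
        Finset.sum_congr rfl fun R _ => Finset.sum_comm
    _ = ∑ L, ∑ R, ∑ M, f (Ribbon.flip R) (Ribbon.flip M) (Ribbon.flip L) := Finset.sum_comm
    _ = _ := Finset.sum_congr rfl fun L _ => Finset.sum_comm

lemma excess_flip (L M R M' : Ribbon n d) :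
    excess R.flip M.flip L.flip M'.flip = excess L M R M' := by
  simp only [excess, Ribbon.flip]; ring

lemma coeff_flip (q : ℝ) (i : ℕ) (R : Ribbon n d) : coeff q i R.flip = coeff q i R := by
  classical
  induction i generalizing R with
  | zero =>
    simp only [coeff]
    exact if_congr ⟨fun h => isMiddleFactor_flip h, fun h => isMiddleFactor_flip h⟩ rfl rfl
  | succ i ih =>
    rw [coeff_succ, coeff_succ, sum_flip]
    refine Finset.sum_congr rfl fun L _ => Finset.sum_congr rfl fun M _ =>
      Finset.sum_congr rfl fun R' _ => ?_
    rw [ih, excess_flip]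
    exact if_congr isStep_flip_iff rfl rfl

/-- The members of `X` that are pairs of distinct vertices in `V`. -/
def pairsIn (X : Finset (Sym2 (Fin n))) (V : Finset (Fin n)) : Finset (Sym2 (Fin n)) :=
  X.filter fun e => ¬ e.IsDiag ∧ ∀ v ∈ e, v ∈ V

lemma mem_pairsIn {X : Finset (Sym2 (Fin n))} {V : Finset (Fin n)} {e : Sym2 (Fin n)} :
    e ∈ pairsIn X V ↔ e ∈ X ∧ ¬ e.IsDiag ∧ ∀ v ∈ e, v ∈ V := by
  simp only [pairsIn, Finset.mem_filter]

/-- For a left and a right factor, disjointness of the edge sets follows from the condition on the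
vertices, because these factors have no edges inside the separators. -/
lemma disjointFactors_iff {L M R : Ribbon n d} (hc : Composable L M R) (hL : IsLeftFactor L)
    (hR : IsRightFactor R) :
    DisjointFactors L M R ↔ L.verts ∩ M.verts = M.left ∧ M.verts ∩ R.verts = M.right ∧
      L.verts ∩ R.verts = M.left ∩ M.right := by
  refine ⟨fun h => h.2, fun h => ⟨⟨?_, ?_, ?_⟩, h⟩⟩
  · rw [Finset.disjoint_left]
    intro e h1 h2
    obtain ⟨v, hv, hvS⟩ := hL.2.2.2 e h1
    rw [hc.1, ← h.1, Finset.mem_inter] at hvS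
    exact hvS ⟨L.mem_verts e h1 v hv, M.mem_verts e h2 v hv⟩
  · rw [Finset.disjoint_left]
    intro e h1 h2
    obtain ⟨v, hv, hvS⟩ := hR.2.2.2 e h2
    rw [← hc.2, ← h.2.1, Finset.mem_inter] at hvS
    exact hvS ⟨M.mem_verts e h1 v hv, R.mem_verts e h2 v hv⟩
  · rw [Finset.disjoint_left]
    intro e h1 h2
    obtain ⟨v, hv, hvS⟩ := hL.2.2.2 e h1
    have : v ∈ L.verts ∩ R.verts := Finset.mem_inter.2 ⟨L.mem_verts e h1 v hv, R.mem_verts e h2 v hv⟩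
    rw [h.2.2, Finset.mem_inter, ← hc.1] at this
    exact hvS this.1

/-- Change the edges of a ribbon by the symmetric difference with those pairs in `X` that lie
inside its vertex set. -/
def Ribbon.toggle (X : Finset (Sym2 (Fin n))) (R : Ribbon n d) : Ribbon n d where
  left := R.left
  right := R.right
  verts := R.verts
  edges := symmDiff R.edges (pairsIn X R.verts)
  left_subset := R.left_subset
  right_subset := R.right_subset
  card_left := R.card_left
  card_right := R.card_right
  not_isDiag := by
    intro e he
    rw [Finset.mem_symmDiff, mem_pairsIn] at he
    rcases he with he | he
    · exact R.not_isDiag e he.1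
    · exact he.1.2.1
  mem_verts := by
    intro e he
    rw [Finset.mem_symmDiff, mem_pairsIn] at he
    rcases he with he | he
    · exact R.mem_verts e he.1
    · exact he.1.2.2

lemma Ribbon.toggle_toggle (X : Finset (Sym2 (Fin n))) (R : Ribbon n d) :
    (R.toggle X).toggle X = R := by
  ext1 <;> try rfl
  change symmDiff (symmDiff R.edges (pairsIn X R.verts)) (pairsIn X R.verts) = R.edges
  rw [symmDiff_assoc, symmDiff_self, symmDiff_bot]

/-- Toggling edges, as an involution of the set of ribbons. -/
def toggleEquiv (d : ℕ) (X : Finset (Sym2 (Fin n))) : Ribbon n d ≃ Ribbon n d :=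
  ⟨Ribbon.toggle X, Ribbon.toggle X, Ribbon.toggle_toggle X, Ribbon.toggle_toggle X⟩

lemma sum_toggle (X : Finset (Sym2 (Fin n))) (f : Ribbon n d → ℝ) :
    ∑ R, f (Ribbon.toggle X R) = ∑ R, f R := (toggleEquiv d X).sum_comp f

lemma toggle_edges_iff {X : Finset (Sym2 (Fin n))} {R : Ribbon n d} {A : Finset (Fin n)}
    (hX : ∀ e ∈ X, ∀ v ∈ e, v ∈ A) (e : Sym2 (Fin n)) (he : ¬ (∀ x ∈ e, x ∈ A)) :
    e ∈ (R.toggle X).edges ↔ e ∈ R.edges := by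
  have : e ∉ X := fun h => he (hX e h)
  simp [Ribbon.toggle, Finset.mem_symmDiff, mem_pairsIn, this]

lemma isMiddleFactor_toggle {X : Finset (Sym2 (Fin n))} {R : Ribbon n d}
    (hX : ∀ e ∈ X, ∀ v ∈ e, v ∈ R.left) (h : IsMiddleFactor R) : IsMiddleFactor (R.toggle X) := by
  have hE := toggle_edges_iff (R := R) hX
  refine ⟨(isLeftmostSep_congr hE).2 h.1, ?_, ?_⟩
  · exact isRightmostSep_right_iff.2 ((isMinSep_congr hE).2 h.2.1.1)
  · intro v hv h1 h2
    obtain ⟨e, he, hve⟩ := h.2.2 v hv h1 h2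
    exact ⟨e, (hE e fun h => h1 (h v hve)).2 he, hve⟩

lemma isLeftFactor_toggle {X : Finset (Sym2 (Fin n))} {R : Ribbon n d}
    (hX : ∀ e ∈ X, ∀ v ∈ e, v ∈ R.left) (hX' : ∀ e ∈ X, ∃ v ∈ e, v ∉ R.right)
    (h : IsLeftFactor R) : IsLeftFactor (R.toggle X) := by
  have hE := toggle_edges_iff (R := R) hX
  refine ⟨(isLeftmostSep_congr hE).2 h.1, ?_, ?_, ?_⟩
  · exact isRightmostSep_right_iff.2 ((isMinSep_congr hE).2 h.2.1.1)
  · intro v hv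
    have : reach (R.toggle X).edges R.left R.right = reach R.edges R.left R.right :=
      reach_congr hE
    exact (h.2.2.1 v hv).imp_right (Or.imp_right fun hv => this.symm ▸ hv)
  · intro e he
    rcases Finset.mem_symmDiff.1 he with he | he
    · exact h.2.2.2 e he.1
    · exact hX' e (mem_pairsIn.1 he.1).1

/-- Edges inside the first end can be moved between the factors: those not inside the separator
`S` are toggled in the left factor, the others in the middle ribbon. -/
lemma IsStep.toggle {L M R M' : Ribbon n d} (h : IsStep L M R M') {X : Finset (Sym2 (Fin n))}
    (hX : ∀ e ∈ X, ∀ v ∈ e, v ∈ M'.left) :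
    IsStep (L.toggle (X.filter fun e => ∃ v ∈ e, v ∉ M.left))
      (M.toggle (X.filter fun e => ∀ v ∈ e, v ∈ M.left)) R (M'.toggle X) := by
  set X₁ := X.filter fun e => ∃ v ∈ e, v ∉ M.left with hX₁
  set X₂ := X.filter fun e => ∀ v ∈ e, v ∈ M.left with hX₂
  have hSL : M.left = L.right := h.composable.1.symm
  have hXL : ∀ e ∈ X, ∀ v ∈ e, v ∈ L.left := fun e he v hv => h.left_eq ▸ hX e he v hv
  have hleft : L.left ⊆ M'.verts := h.left_eq ▸ M'.left_subset
  have hprod : prodEdges (L.toggle X₁) (M.toggle X₂) R = (M'.toggle X).edges := by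
    have hsplit : symmDiff (pairsIn X₁ L.verts) (pairsIn X₂ M.verts) = pairsIn X M'.verts := by
      ext e
      rw [Finset.mem_symmDiff, mem_pairsIn, mem_pairsIn, mem_pairsIn, hX₁, hX₂,
        Finset.mem_filter, Finset.mem_filter]
      by_cases he : e ∈ X
      · have b1 : ∀ v ∈ e, v ∈ L.verts := fun v hv => L.left_subset (hXL e he v hv)
        have b2 : ∀ v ∈ e, v ∈ M'.verts := fun v hv => hleft (hXL e he v hv)
        have b3 : (∃ v ∈ e, v ∉ M.left) ↔ ¬ ∀ v ∈ e, v ∈ M.left := by push Not; rfl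
        rw [b3]
        by_cases hS : ∀ v ∈ e, v ∈ M.left
        · have b4 : ∀ v ∈ e, v ∈ M.verts := fun v hv => M.left_subset (hS v hv)
          simp only [eq_true he, eq_true b2, eq_true b4, eq_true hS, true_and, and_true, not_true,
            false_and, not_false_iff, false_or]
        · simp only [eq_true he, eq_true b1, eq_true b2, eq_false hS, true_and, and_true,
            false_and, and_false, not_false_iff, or_false]
      · simp only [he, false_and, or_self]
    change symmDiff (symmDiff (symmDiff L.edges (pairsIn X₁ L.verts))
      (symmDiff M.edges (pairsIn X₂ M.verts))) R.edges = symmDiff M'.edges (pairsIn X M'.verts)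
    rw [symmDiff_symmDiff_symmDiff_comm, symmDiff_right_comm, hsplit, h.edges_eq, prodEdges]
  have hE : ∀ e, ¬ (∀ x ∈ e, x ∈ L.left) → (e ∈ (M'.toggle X).edges ↔ e ∈ prodEdges L M R) :=
    fun e he => h.edges_eq ▸ toggle_edges_iff hXL e he
  have hE' : ∀ e, ¬ (∀ x ∈ e, x ∈ L.left ∪ repeatedVerts L M R) →
      (e ∈ (M'.toggle X).edges ↔ e ∈ prodEdges L M R) :=
    fun e he => hE e fun h' => he fun x hx => Finset.mem_union_left _ (h' x hx)
  refine ⟨h.composable, isLeftFactor_toggle ?_ ?_ h.leftFactor, h.rightFactor, ?_, h.left_eq,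
    h.right_eq, ?_, ?_, h.verts_eq, hprod.symm⟩
  · exact fun e he => hXL e (Finset.mem_filter.1 he).1
  · intro e he
    rw [← hSL]
    exact (Finset.mem_filter.1 he).2
  · exact fun hd => h.not_disjoint
      ((disjointFactors_iff h.composable h.leftFactor h.rightFactor).2 hd.2)
  · rw [hprod]
    exact (isMinSep_congr hE).2 h.minSep_left
  · rw [hprod]
    exact (isMinSep_congr hE').2 h.minSep_right

/-- Edges inside the first end do not influence the coefficients. -/
lemma coeff_toggle_left (q : ℝ) (i : ℕ) (R : Ribbon n d) {X : Finset (Sym2 (Fin n))}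
    (hX : ∀ e ∈ X, ∀ v ∈ e, v ∈ R.left) : coeff q i (R.toggle X) = coeff q i R := by
  classical
  induction i generalizing R X with
  | zero =>
    simp only [coeff]
    refine if_congr ⟨fun h => ?_, fun h => isMiddleFactor_toggle hX h⟩ rfl rfl
    rw [← R.toggle_toggle X]
    exact isMiddleFactor_toggle hX h
  | succ i ih =>
    rw [coeff_succ, coeff_succ]
    -- the contribution of all triples with a given separator `S` is invariant
    have key : ∀ S : Finset (Fin n), ∀ L : Ribbon n d, ∀ M : Ribbon n d, ∀ R' : Ribbon n d,
        M.left = S →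
        ((if IsStep (L.toggle (X.filter fun e => ∃ v ∈ e, v ∉ S))
            (M.toggle (X.filter fun e => ∀ v ∈ e, v ∈ S)) R' (R.toggle X)
          then coeff q i (M.toggle (X.filter fun e => ∀ v ∈ e, v ∈ S)) *
            q ^ excess (L.toggle (X.filter fun e => ∃ v ∈ e, v ∉ S))
              (M.toggle (X.filter fun e => ∀ v ∈ e, v ∈ S)) R' (R.toggle X) else 0) =
          if IsStep L M R' R then coeff q i M * q ^ excess L M R' R else 0) := by
      rintro S L M R' rfl
      rw [ih M (fun e he => (Finset.mem_filter.1 he).2)]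
      refine if_congr ⟨fun h => ?_, fun h => h.toggle hX⟩ rfl rfl
      have := h.toggle hX
      rw [Ribbon.toggle_toggle] at this
      change IsStep (Ribbon.toggle _ (L.toggle _)) (Ribbon.toggle _ (M.toggle _)) R' _ at this
      erw [Ribbon.toggle_toggle, Ribbon.toggle_toggle] at this
      exact this
    have split : ∀ g : Ribbon n d → Ribbon n d → ℝ, ∑ L, ∑ M, g L M =
        ∑ S : Finset (Fin n), ∑ L, ∑ M, if M.left = S then g L M else 0 := by
      intro g
      refine Eq.trans ?_ Finset.sum_comm
      refine Finset.sum_congr rfl fun L _ => ?_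
      refine Eq.trans ?_ Finset.sum_comm
      refine Finset.sum_congr rfl fun M _ => ?_
      rw [Finset.sum_ite_eq, if_pos (Finset.mem_univ _)]
    rw [split, split]
    refine Finset.sum_congr rfl fun S _ => ?_
    rw [← sum_toggle (X.filter fun e => ∃ v ∈ e, v ∉ S)]
    refine Finset.sum_congr rfl fun L _ => ?_
    rw [← sum_toggle (X.filter fun e => ∀ v ∈ e, v ∈ S)]
    refine Finset.sum_congr rfl fun M _ => ?_
    by_cases hM : M.left = S
    · refine (if_pos hM).trans (Eq.trans ?_ (if_pos hM).symm)
      exact Finset.sum_congr rfl fun R' _ => key S L M R' hM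
    · exact (if_neg hM).trans (if_neg hM).symm

end Recursion

/-! ### The intersection trade-off -/

section Tradeoff

variable {n d : ℕ}

/-- The isolated vertices of a ribbon outside its ends. -/
def Ribbon.isolated (R : Ribbon n d) : Finset (Fin n) :=
  R.verts.filter fun v => v ∉ R.left ∧ v ∉ R.right ∧ ∀ e ∈ R.edges, v ∉ e

/-- The minimum size of a separator of the two ends of a ribbon. -/
noncomputable def Ribbon.sep (R : Ribbon n d) : ℕ := sepNum R.verts R.edges R.left R.right

lemma mem_isolated {R : Ribbon n d} {v : Fin n} :
    v ∈ R.isolated ↔ v ∈ R.verts ∧ v ∉ R.left ∧ v ∉ R.right ∧ ∀ e ∈ R.edges, v ∉ e := by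
  simp only [Ribbon.isolated, Finset.mem_filter]

lemma mem_or_exists_edge_of_mem_reach {E : Finset (Sym2 (Fin n))} {A S : Finset (Fin n)}
    {v : Fin n} (h : v ∈ reach E A S) : v ∈ A ∨ ∃ e ∈ E, v ∈ e :=
  reach_induction (P := fun v => v ∈ A ∨ ∃ e ∈ E, v ∈ e) (fun _ ha _ => Or.inl ha)
    (fun u v _ _ he _ => Or.inr ⟨s(u, v), he, by simp⟩) v h

lemma notMem_reach_of_isolated {R : Ribbon n d} {S : Finset (Fin n)} {v : Fin n}
    (hv : v ∈ R.isolated) : v ∉ reach R.edges R.left S ∧ v ∉ reach R.edges R.right S := by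
  rw [mem_isolated] at hv
  constructor <;> intro h <;> rcases mem_or_exists_edge_of_mem_reach h with h | ⟨e, he, hve⟩
  · exact hv.2.1 h
  · exact hv.2.2.2 e he hve
  · exact hv.2.2.1 h
  · exact hv.2.2.2 e he hve

lemma reach_disjoint {E : Finset (Sym2 (Fin n))} {A B S : Finset (Fin n)}
    (h : Separates E A B S) {v : Fin n} (h1 : v ∈ reach E A S) : v ∉ reach E B S := by
  intro h2
  have : ∀ w ∈ reach E B S, w ∉ reach E A S :=
    reach_induction (fun b hb _ h3 => separates_iff.1 h b h3 hb)
      fun u w hu huS he _ hw => hu (mem_reach_of_edge hw (Sym2.eq_swap ▸ he) huS)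
  exact this v h2 h1

/-- A minimum separator of the ends contains no isolated vertex outside the ends. -/
lemma notMem_of_isolated {R : Ribbon n d} {P : Finset (Fin n)} (hP : P ⊆ R.verts)
    (hsep : Separates R.edges R.left R.right P) (hc : P.card = R.sep) {v : Fin n}
    (hv : v ∈ R.isolated) : v ∉ P := by
  intro hvP
  rw [mem_isolated] at hv
  have h : Separates R.edges R.left R.right (P.erase v) := by
    refine separates_of_closed (fun u => u ∈ reach R.edges R.left P) ?_ ?_ ?_
    · intro a ha haP
      have : a ≠ v := fun h => hv.2.1 (h ▸ ha)
      exact mem_reach_of_mem ha fun h => haP (Finset.mem_erase.2 ⟨this, h⟩)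
    · intro u w hu _ he hw
      have : w ≠ v := fun h => hv.2.2.2 _ he (by simp [h])
      exact mem_reach_of_edge hu he fun h => hw (Finset.mem_erase.2 ⟨this, h⟩)
    · exact fun b hb _ h => separates_iff.1 hsep b h hb
  have h1 := sepNum_le ((Finset.erase_subset v P).trans hP) h
  have h2 := Finset.card_erase_lt_of_mem hvP
  rw [hc] at h2
  exact absurd h1 (not_le.2 h2)

lemma mem_repeatedVerts {L M R : Ribbon n d} {v : Fin n} : v ∈ repeatedVerts L M R ↔
    (v ∈ L.verts ∧ v ∈ M.verts) ∨ (v ∈ L.verts ∧ v ∈ R.verts) ∨ (v ∈ M.verts ∧ v ∈ R.verts) := by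
  simp only [repeatedVerts, Finset.mem_union, Finset.mem_inter, or_assoc]

lemma IsStep.mem_verts_iff {L M R M' : Ribbon n d} (h : IsStep L M R M') {v : Fin n} :
    v ∈ M'.verts ↔ v ∈ L.verts ∨ v ∈ M.verts ∨ v ∈ R.verts := by
  simp only [h.verts_eq, prodVerts, Finset.mem_union, or_assoc]

lemma IsStep.mem_edges_iff {L M R M' : Ribbon n d} (h : IsStep L M R M') {e : Sym2 (Fin n)} :
    e ∈ M'.edges ↔ (((e ∈ L.edges ∧ e ∉ M.edges) ∨ (e ∈ M.edges ∧ e ∉ L.edges)) ∧ e ∉ R.edges) ∨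
      (e ∈ R.edges ∧ ¬ ((e ∈ L.edges ∧ e ∉ M.edges) ∨ (e ∈ M.edges ∧ e ∉ L.edges))) := by
  simp only [h.edges_eq, prodEdges, Finset.mem_symmDiff]

/-- The first end of the product is not larger than the separator of it from the second end and the
repeated vertices that consists of the vertices of `L` in `P` and of the repeated vertices of `L`
within reach of the first end. -/
lemma IsStep.card_left_le {L M R M' : Ribbon n d} (h : IsStep L M R M') (P : Finset (Fin n)) :
    M'.left.card ≤
      (L.verts ∩ (P ∪ (repeatedVerts L M R ∩ reach M'.edges M'.left P))).card := by
  have hmin := h.minSep_left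
  rw [← h.verts_eq, ← h.edges_eq] at hmin
  rw [← h.left_eq]
  refine hmin.2.2 _ ?_ ?_
  · exact fun v hv => h.mem_verts_iff.2 (Or.inl (Finset.mem_inter.1 hv).1)
  refine separates_of_closed (fun v => v ∈ L.verts ∧ v ∉ repeatedVerts L M R ∧
    v ∈ reach M'.edges L.left P) ?_ ?_ ?_
  · intro a ha haS
    have haL := L.left_subset ha
    simp only [Finset.mem_inter, Finset.mem_union, not_and, not_or] at haS
    have h1 := mem_reach_of_mem (E := M'.edges) ha (haS haL).1
    exact ⟨haL, fun h2 => (haS haL).2 h2 h1, h1⟩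
  · rintro u w ⟨hu1, hu2, hu3⟩ - he hw
    have hwL : w ∈ L.verts := by
      rw [mem_repeatedVerts] at hu2
      have h1 : s(u, w) ∉ M.edges := fun h' => hu2 (Or.inl ⟨hu1, M.mem_verts _ h' u (by simp)⟩)
      have h2 : s(u, w) ∉ R.edges :=
        fun h' => hu2 (Or.inr (Or.inl ⟨hu1, R.mem_verts _ h' u (by simp)⟩))
      have h3 : s(u, w) ∈ L.edges := by
        rw [h.mem_edges_iff] at he
        grind
      exact L.mem_verts _ h3 w (by simp)
    simp only [Finset.mem_inter, Finset.mem_union, not_and, not_or] at hw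
    have h1 := mem_reach_of_edge hu3 he (hw hwL).1
    exact ⟨hwL, fun h2 => (hw hwL).2 h2 h1, h1⟩
  · rintro b hb - ⟨hb1, hb2, -⟩
    rcases Finset.mem_union.1 hb with hb | hb
    · exact hb2 (mem_repeatedVerts.2 (Or.inr (Or.inl ⟨hb1, R.right_subset hb⟩)))
    · exact hb2 hb

lemma IsStep.card_right_le {L M R M' : Ribbon n d} (h : IsStep L M R M') (P : Finset (Fin n)) :
    M'.right.card ≤
      (R.verts ∩ (P ∪ (repeatedVerts L M R ∩ reach M'.edges M'.right P))).card := by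
  have := h.flip.card_left_le P
  rwa [repeatedVerts_flip] at this

open Classical in
/-- A separator of the two ends of the middle ribbon `M`, built from a set `P` of vertices. Along a
path of `M` that starts in the first end and avoids it, every vertex stays outside `R`, and is
reachable from the first end of the product without passing through `P` unless it is a vertex of
`L` that is isolated in the product. Hence the path does not arrive at the second end, which is part
of `R`. -/
lemma IsStep.sep_le {L M R M' : Ribbon n d} (h : IsStep L M R M') (P : Finset (Fin n)) :
    M.sep ≤ (M.verts.filter fun v => v ∈ P ∨ (v ∈ L.verts ∧ v ∈ R.verts) ∨
      (v ∈ L.verts ∧ v ∈ reach M'.edges M'.right P) ∨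
      (v ∈ R.verts ∧ v ∈ reach M'.edges M'.left P) ∨
      (v ∈ repeatedVerts L M R ∧ v ∉ reach M'.edges M'.left P ∧
        v ∉ reach M'.edges M'.right P ∧ v ∉ M'.isolated)).card := by
  refine sepNum_le (Finset.filter_subset _ _) ?_
  refine separates_of_closed (fun v => v ∈ M.verts ∧ v ∉ R.verts ∧
    (v ∈ reach M'.edges M'.left P ∨ (v ∈ L.verts ∧ v ∈ M'.isolated))) ?_ ?_ ?_
  · intro a ha haS
    have h1 : a ∈ M.verts := M.left_subset ha
    have h2 : a ∈ L.verts := L.right_subset (h.composable.1 ▸ ha)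
    have h3 : a ∈ repeatedVerts L M R := mem_repeatedVerts.2 (Or.inl ⟨h2, h1⟩)
    rw [Finset.mem_filter] at haS
    grind
  · rintro u w ⟨hu1, hu2, hu3⟩ - he hw
    have hw1 : w ∈ M.verts := M.mem_verts _ he w (by simp)
    rw [Finset.mem_filter] at hw
    have hR : s(u, w) ∉ R.edges := fun h' => hu2 (R.mem_verts _ h' u (by simp))
    have hreach : w ∉ L.verts → w ∈ reach M'.edges M'.left P := by
      intro hwL
      have hL : s(u, w) ∉ L.edges := fun h' => hwL (L.mem_verts _ h' w (by simp))
      have he' : s(u, w) ∈ M'.edges := by rw [h.mem_edges_iff]; grind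
      have hu : u ∉ M'.isolated := fun h' => (mem_isolated.1 h').2.2.2 _ he' (by simp)
      refine mem_reach_of_edge (hu3.resolve_right fun h' => hu h'.2) he' ?_
      grind
    have hwR : w ∉ R.verts := by
      intro hwR
      by_cases hwL : w ∈ L.verts
      · grind
      · have := hreach hwL
        grind
    refine ⟨hw1, hwR, ?_⟩
    by_cases hwL : w ∈ L.verts
    · have : w ∈ repeatedVerts L M R := mem_repeatedVerts.2 (Or.inl ⟨hwL, hw1⟩)
      grind
    · exact Or.inl (hreach hwL)
  · rintro b hb - ⟨-, hbR, -⟩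
    exact hbR (R.left_subset (h.composable.2 ▸ hb))

/-- A vertex of a single factor that is isolated in the product is isolated in the middle
ribbon. -/
lemma IsStep.isolated_of_notMem {L M R M' : Ribbon n d} (h : IsStep L M R M') {v : Fin n}
    (hv : v ∈ M'.isolated) (hU : v ∉ repeatedVerts L M R) : v ∈ M.isolated := by
  rw [mem_isolated, h.mem_verts_iff] at hv
  obtain ⟨hv1, hv2, hv3, hv4⟩ := hv
  rw [mem_repeatedVerts] at hU
  by_cases hL : v ∈ L.verts
  · exfalso
    have hM : v ∉ M.verts := by grind
    have hR : v ∉ R.verts := by grind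
    rcases h.leftFactor.2.2.1 v hL with h' | h' | h'
    · exact hv2 (h.left_eq ▸ h')
    · exact hM (M.left_subset (h.composable.1 ▸ h'))
    · rcases mem_or_exists_edge_of_mem_reach h' with h' | ⟨e, he, hve⟩
      · exact hv2 (h.left_eq ▸ h')
      · refine hv4 e (h.mem_edges_iff.2 ?_) hve
        have h1 : e ∉ M.edges := fun h' => hM (M.mem_verts e h' v hve)
        have h2 : e ∉ R.edges := fun h' => hR (R.mem_verts e h' v hve)
        grind
  by_cases hR : v ∈ R.verts
  · exfalso
    have hM : v ∉ M.verts := by grind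
    rcases h.rightFactor.2.2.1 v hR with h' | h' | h'
    · exact hv3 (h.right_eq ▸ h')
    · exact hM (M.right_subset (h.composable.2 ▸ h'))
    · rcases mem_or_exists_edge_of_mem_reach h' with h' | ⟨e, he, hve⟩
      · exact hv3 (h.right_eq ▸ h')
      · refine hv4 e (h.mem_edges_iff.2 ?_) hve
        have h1 : e ∉ M.edges := fun h' => hM (M.mem_verts e h' v hve)
        have h2 : e ∉ L.edges := fun h' => hL (L.mem_verts e h' v hve)
        grind
  refine mem_isolated.2 ⟨by grind, fun h' => hL (L.right_subset (h.composable.1 ▸ h')),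
    fun h' => hR (R.left_subset (h.composable.2 ▸ h')), fun e he hve => hv4 e ?_ hve⟩
  rw [h.mem_edges_iff]
  have h1 : e ∉ R.edges := fun h' => hR (R.mem_verts e h' v hve)
  have h2 : e ∉ L.edges := fun h' => hL (L.mem_verts e h' v hve)
  grind

lemma card_eq_sum_indicator (A : Finset (Fin n)) : A.card = ∑ v, if v ∈ A then 1 else 0 := by
  simp

/-- The contribution of a single vertex to the intersection trade-off. The propositions say that the
vertex belongs to the separators of the three factors (`A₁`, `A₂`, `A₃`), to the minimum separator
of the product (`P`), to the sets within reach of the first and of the second end of the product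
without passing through `P` (`X`, `Y`), to the vertex sets of the factors and the product (`VL`,
`VR`, `VM`, `V'`), or to the isolated vertices of the middle ribbon and the product (`Z`, `Z'`). -/
lemma tradeoff_pointwise {X Y Z' Z V' VL VM VR P A₁ A₂ A₃ : Prop} [Decidable Z'] [Decidable Z]
    [Decidable V'] [Decidable VL] [Decidable VM] [Decidable VR] [Decidable P] [Decidable A₁]
    [Decidable A₂] [Decidable A₃]
    (h₁ : A₁ → VL ∧ (P ∨ X)) (h₁' : A₁ → P ∨ VM ∨ VR)
    (h₂ : A₂ → VR ∧ (P ∨ Y)) (h₂' : A₂ → P ∨ VM ∨ VL)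
    (h₃ : A₃ → VM ∧ (P ∨ (VL ∧ VR) ∨ (VL ∧ Y) ∨ (VR ∧ X) ∨ (VL ∨ VR) ∧ ¬ X ∧ ¬ Y ∧ ¬ Z'))
    (hZ : Z' → ¬ P ∧ ¬ X ∧ ¬ Y) (hZ' : Z' → VL ∧ VM ∨ VL ∧ VR ∨ VM ∧ VR ∨ Z) (hXY : X → ¬ Y)
    (hV : V' ↔ VL ∨ VM ∨ VR) (hZV : Z' → V') :
    (if A₁ then 1 else 0) + (if A₂ then 1 else 0) + (if A₃ then 1 else 0) +
      (if Z' then 1 else 0) + (if V' then 1 else 0) ≤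
    (if P then 1 else 0) + (if Z then 1 else 0) + (if VL then 1 else 0) +
      (if VM then 1 else 0) + (if VR then 1 else 0) := by
  grind (splits := 30)

/-- The intersection trade-off: the number of repetitions pays for the isolated vertices that
appear in the product and for the drop in connectivity between its ends. A minimum separator `P`
of the product yields separators in the three factors, whose sizes are compared with
`P` vertex by vertex. -/
theorem IsStep.tradeoff {L M R M' : Ribbon n d} (h : IsStep L M R M') :
    M'.left.card + M'.right.card + M.sep + M'.isolated.card + M'.verts.card ≤
      M'.sep + M.isolated.card + L.verts.card + M.verts.card + R.verts.card := by
  classical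
  obtain ⟨P, hPV, hPs, hPc⟩ := exists_card_eq_sepNum (E := M'.edges) (B := M'.right) M'.left_subset
  have h1 := h.card_left_le P
  have h2 := h.card_right_le P
  have h3 := h.sep_le P
  rw [show M'.sep = P.card from hPc.symm]
  refine (add_le_add_left (add_le_add_left (add_le_add (add_le_add h1 h2) h3) _) _).trans ?_
  simp only [card_eq_sum_indicator, ← Finset.sum_add_distrib]
  refine Finset.sum_le_sum fun v _ => ?_
  refine tradeoff_pointwise (X := v ∈ reach M'.edges M'.left P)
    (Y := v ∈ reach M'.edges M'.right P) ?_ ?_ ?_ ?_ ?_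
    (fun hv => ⟨notMem_of_isolated hPV hPs hPc hv, notMem_reach_of_isolated hv⟩) ?_
    (fun hv => reach_disjoint hPs hv) h.mem_verts_iff (fun hv => (mem_isolated.1 hv).1)
  · rw [Finset.mem_inter, Finset.mem_union, Finset.mem_inter]; grind
  · rw [Finset.mem_inter, Finset.mem_union, Finset.mem_inter, mem_repeatedVerts]; grind
  · rw [Finset.mem_inter, Finset.mem_union, Finset.mem_inter]; grind
  · rw [Finset.mem_inter, Finset.mem_union, Finset.mem_inter, mem_repeatedVerts]; grind
  · rw [Finset.mem_filter, mem_repeatedVerts]; grind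
  · intro hv
    by_cases hU : v ∈ repeatedVerts L M R
    · rw [mem_repeatedVerts] at hU; grind
    · have := h.isolated_of_notMem hv hU; grind

/-- A left factor, a right factor and a middle ribbon that violate disjointness have at least one
intersection. -/
lemma IsStep.one_le_excess {L M R M' : Ribbon n d} (h : IsStep L M R M') :
    1 ≤ excess L M R M' := by
  classical
  have hS1 : ∀ v, v ∈ M.left → v ∈ L.verts ∧ v ∈ M.verts :=
    fun v hv => ⟨L.right_subset (h.composable.1 ▸ hv), M.left_subset hv⟩
  have hT1 : ∀ v, v ∈ M.right → v ∈ R.verts ∧ v ∈ M.verts :=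
    fun v hv => ⟨R.left_subset (h.composable.2 ▸ hv), M.right_subset hv⟩
  have hle : ∀ v ∈ (Finset.univ : Finset (Fin n)), (if v ∈ M.left then 1 else 0) +
      (if v ∈ M.right then 1 else 0) + (if v ∈ M'.verts then 1 else 0) ≤
      (if v ∈ L.verts then 1 else 0) + (if v ∈ M.verts then 1 else 0) +
        (if v ∈ R.verts then 1 else 0) := by
    intro v _
    have a1 := hS1 v
    have a2 := hT1 v
    have a3 := h.mem_verts_iff (v := v)
    clear h
    grind
  have hlt : M.left.card + M.right.card + M'.verts.card <
      L.verts.card + M.verts.card + R.verts.card := by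
    by_contra hcon
    simp only [card_eq_sum_indicator, ← Finset.sum_add_distrib] at hcon
    -- equality of the sums forces equality at each vertex, which is the disjointness condition
    have heq := (Finset.sum_eq_sum_iff_of_le hle).1
      (le_antisymm (Finset.sum_le_sum hle) (not_lt.1 hcon))
    refine h.not_disjoint ((disjointFactors_iff h.composable h.leftFactor h.rightFactor).2 ?_)
    have a3 := fun v => h.mem_verts_iff (v := v)
    have a4 := fun v => heq v (Finset.mem_univ v)
    clear heq hcon hle h
    refine ⟨?_, ?_, ?_⟩ <;> ext v <;> specialize hS1 v <;> specialize hT1 v <;>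
      specialize a3 v <;> specialize a4 v <;> grind
  simp only [excess]
  omega

end Tradeoff

/-! ### Counting ribbons -/

section Counting

variable {n d : ℕ}

open Classical in
/-- Ribbons with given ends and vertices, all of whose edges have a vertex outside a set `K`. -/
lemma card_ribbons_le (A B V K : Finset (Fin n)) (hK : K ⊆ V) :
    (Finset.univ.filter fun R : Ribbon n d => R.left = A ∧ R.right = B ∧ R.verts = V ∧
      ∀ e ∈ R.edges, ∃ v ∈ e, v ∉ K).card ≤ 2 ^ ((V.card - K.card) * V.card) := by
  have hcard : (((V \ K) ×ˢ V).image fun x => s(x.1, x.2)).card ≤ (V.card - K.card) * V.card := by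
    refine Finset.card_image_le.trans ?_
    rw [Finset.card_product, Finset.card_sdiff_of_subset hK]
  refine le_trans ?_ (Nat.pow_le_pow_right two_pos hcard)
  rw [← Finset.card_powerset]
  refine Finset.card_le_card_of_injOn (fun R => R.edges) ?_ ?_
  · intro R hR
    obtain ⟨-, -, hV, hE⟩ := (Finset.mem_filter.1 hR).2
    rw [Finset.mem_coe, Finset.mem_powerset]
    intro e he
    obtain ⟨v, hv, hvK⟩ := hE e he
    obtain ⟨w, rfl⟩ := hv
    rw [Finset.mem_image]
    have hmem := R.mem_verts _ he
    rw [hV] at hmem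
    exact ⟨(v, w), Finset.mem_product.2 ⟨Finset.mem_sdiff.2 ⟨hmem v (by simp), hvK⟩,
      hmem w (by simp)⟩, rfl⟩
  · intro R hR R' hR' h
    obtain ⟨h1, h2, h3, -⟩ := (Finset.mem_filter.1 hR).2
    obtain ⟨h1', h2', h3', -⟩ := (Finset.mem_filter.1 hR').2
    exact Ribbon.ext (h1.trans h1'.symm) (h2.trans h2'.symm) (h3.trans h3'.symm) h

/-- The weight of a left factor in the counting of triples. A left factor with at most `τ` vertices
has at most `τ * (|V| - |right|)` possible edges, so that the weights of all left factors with given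
ends and vertices add up to at most `1`. -/
noncomputable def factorWeight (τ : ℕ) (R : Ribbon n d) : ℝ :=
  ((2 : ℝ) ^ (τ * (R.verts.card - R.right.card)))⁻¹

lemma factorWeight_nonneg (τ : ℕ) (R : Ribbon n d) : 0 ≤ factorWeight τ R := by
  unfold factorWeight; positivity

/-- The properties of a left factor that are used in counting: the first end is `I`, all vertices
belong to `V`, and there are no edges inside the second end. -/
def IsLeftFactorIn (I V : Finset (Fin n)) (R : Ribbon n d) : Prop :=
  R.left = I ∧ R.verts ⊆ V ∧ ∀ e ∈ R.edges, ∃ v ∈ e, v ∉ R.right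

open Classical in
lemma sum_factorWeight_le {τ : ℕ} {I V : Finset (Fin n)} (hV : V.card ≤ τ) :
    ∑ R : Ribbon n d, (if IsLeftFactorIn I V R then factorWeight τ R else 0) ≤ 4 ^ τ := by
  rw [← Finset.sum_filter]
  rw [← Finset.sum_fiberwise_of_maps_to (t := V.powerset ×ˢ V.powerset)
    (g := fun R : Ribbon n d => (R.right, R.verts))]
  · calc _ ≤ ∑ x ∈ V.powerset ×ˢ V.powerset, (1 : ℝ) := by
          refine Finset.sum_le_sum fun x hx => ?_
          obtain ⟨S, W⟩ := x
          by_cases hSW : S ⊆ W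
          swap
          · rw [Finset.sum_eq_zero]
            · exact zero_le_one
            · intro R hR
              have h := (Finset.mem_filter.1 hR).2
              simp only [Prod.mk.injEq] at h
              exact absurd (h.1 ▸ h.2 ▸ R.right_subset) hSW
          have hW : W.card ≤ τ := by
            rw [Finset.mem_product, Finset.mem_powerset, Finset.mem_powerset] at hx
            exact (Finset.card_le_card hx.2).trans hV
          calc _ ≤ ∑ R ∈ Finset.univ.filter fun R : Ribbon n d => R.left = I ∧ R.right = S ∧
                R.verts = W ∧ ∀ e ∈ R.edges, ∃ v ∈ e, v ∉ S,
                ((2 : ℝ) ^ (τ * (W.card - S.card)))⁻¹ := by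
                refine (Finset.sum_le_sum_of_subset_of_nonneg ?_ ?_).trans_eq
                  (Finset.sum_congr rfl (g := fun _ => _) ?_)
                · intro R hR
                  rw [Finset.mem_filter, Finset.mem_filter] at hR
                  obtain ⟨⟨-, h1, -, h3⟩, h4⟩ := hR
                  simp only [Prod.mk.injEq] at h4
                  rw [Finset.mem_filter]
                  exact ⟨Finset.mem_univ _, h1, h4.1, h4.2, h4.1 ▸ h3⟩
                · exact fun R _ _ => factorWeight_nonneg τ R
                · intro R hR
                  obtain ⟨-, h1, h2, -⟩ := (Finset.mem_filter.1 hR).2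
                  rw [factorWeight, h1, h2]
            _ ≤ 1 := by
                rw [Finset.sum_const, nsmul_eq_mul, ← div_eq_mul_inv, div_le_one (by positivity)]
                have h1 := card_ribbons_le (d := d) I S W S hSW
                have h2 : (2 : ℕ) ^ ((W.card - S.card) * W.card) ≤ 2 ^ (τ * (W.card - S.card)) :=
                  Nat.pow_le_pow_right two_pos (by rw [mul_comm]; exact Nat.mul_le_mul_right _ hW)
                exact_mod_cast h1.trans h2
      _ ≤ 4 ^ τ := by
          rw [Finset.sum_const, Finset.card_product, Finset.card_powerset, nsmul_eq_mul, mul_one]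
          have : (2 : ℝ) ^ V.card ≤ 2 ^ τ := pow_le_pow_right₀ (by norm_num) hV
          calc (((2 ^ V.card * 2 ^ V.card : ℕ)) : ℝ) = 2 ^ V.card * 2 ^ V.card := by push_cast; ring
            _ ≤ 2 ^ τ * 2 ^ τ := by gcongr
            _ = 4 ^ τ := by rw [← mul_pow]; norm_num
  · intro R hR
    obtain ⟨-, -, h2, -⟩ := Finset.mem_filter.1 hR
    rw [Finset.mem_product, Finset.mem_powerset, Finset.mem_powerset]
    exact ⟨R.right_subset.trans h2, h2⟩

open Classical in
/-- Given the other factors and the product, the middle ribbon is determined by its vertex set. -/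
lemma card_middle_le (L R M' : Ribbon n d) :
    (Finset.univ.filter fun M : Ribbon n d => IsStep L M R M').card ≤ 2 ^ M'.verts.card := by
  rw [← Finset.card_powerset]
  refine Finset.card_le_card_of_injOn (fun M => M.verts) ?_ ?_
  · intro M hM
    have h := (Finset.mem_filter.1 hM).2
    rw [Finset.mem_coe, Finset.mem_powerset]
    exact fun v hv => h.mem_verts_iff.2 (Or.inr (Or.inl hv))
  · intro M hM M₁ hM₁ hv
    have h := (Finset.mem_filter.1 hM).2
    have h₁ := (Finset.mem_filter.1 hM₁).2
    refine Ribbon.ext (h.composable.1.symm.trans h₁.composable.1)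
      (h.composable.2.trans h₁.composable.2.symm) hv ?_
    have he := h.edges_eq.symm.trans h₁.edges_eq
    rw [prodEdges, prodEdges, symmDiff_left_inj, symmDiff_right_inj] at he
    exact he

open Classical in
/-- The weighted number of triples in the recursion sum of a ribbon with at most `τ` vertices. -/
lemma sum_triples_le {τ : ℕ} (M' : Ribbon n d) (hτ : M'.verts.card ≤ τ) :
    ∑ L : Ribbon n d, ∑ M : Ribbon n d, ∑ R : Ribbon n d,
      (if IsStep L M R M' then factorWeight τ L * factorWeight τ R.flip else 0) ≤ 32 ^ τ := by
  have hA := sum_factorWeight_le (d := d) (I := M'.left) hτ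
  have hB := sum_factorWeight_le (d := d) (I := M'.right) hτ
  rw [← (flipEquiv n d).sum_comp] at hB
  set a : Ribbon n d → ℝ := fun L => if IsLeftFactorIn M'.left M'.verts L then factorWeight τ L else 0
    with ha
  set b : Ribbon n d → ℝ := fun R => if IsLeftFactorIn M'.right M'.verts R.flip
    then factorWeight τ R.flip else 0 with hb
  have ha0 : ∀ L, 0 ≤ a L := fun L => by
    simp only [ha]; split_ifs; exacts [factorWeight_nonneg _ _, le_rfl]
  have hb0 : ∀ R, 0 ≤ b R := fun R => by
    simp only [hb]; split_ifs; exacts [factorWeight_nonneg _ _, le_rfl]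
  calc _ = ∑ L : Ribbon n d, ∑ R : Ribbon n d, ∑ M : Ribbon n d,
        (if IsStep L M R M' then factorWeight τ L * factorWeight τ R.flip else 0) :=
        Finset.sum_congr rfl fun L _ => Finset.sum_comm
    _ ≤ ∑ L : Ribbon n d, ∑ R : Ribbon n d, a L * b R * 2 ^ τ := by
        refine Finset.sum_le_sum fun L _ => Finset.sum_le_sum fun R _ => ?_
        calc _ ≤ ∑ M : Ribbon n d, (if IsStep L M R M' then a L * b R else 0) := by
              refine Finset.sum_le_sum fun M _ => ?_
              split_ifs with h
              · have h1 : IsLeftFactorIn M'.left M'.verts L :=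
                  ⟨h.left_eq, fun v hv => h.mem_verts_iff.2 (Or.inl hv), h.leftFactor.2.2.2⟩
                have h2 : IsLeftFactorIn M'.right M'.verts R.flip :=
                  ⟨h.right_eq, fun v hv => h.mem_verts_iff.2 (Or.inr (Or.inr hv)),
                    h.rightFactor.2.2.2⟩
                simp only [ha, hb, if_pos h1, if_pos h2, le_refl]
              · exact le_rfl
          _ ≤ a L * b R * 2 ^ τ := by
              rw [← Finset.sum_filter, Finset.sum_const, nsmul_eq_mul, mul_comm]
              refine mul_le_mul_of_nonneg_left ?_ (mul_nonneg (ha0 L) (hb0 R))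
              have h1 := (card_middle_le L R M').trans (Nat.pow_le_pow_right two_pos hτ)
              exact_mod_cast h1
    _ = (∑ L, a L) * (∑ R, b R) * 2 ^ τ := by
        rw [Finset.sum_mul_sum, Finset.sum_mul]
        exact Finset.sum_congr rfl fun L _ => (Finset.sum_mul _ _ _).symm
    _ ≤ 4 ^ τ * 4 ^ τ * 2 ^ τ := by
        refine mul_le_mul_of_nonneg_right ?_ (by positivity)
        exact mul_le_mul hA hB (Finset.sum_nonneg fun R _ => hb0 R) (by positivity)
    _ = 32 ^ τ := by rw [← mul_pow, ← mul_pow]; norm_num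

end Counting

/-! ### The size of the coefficients -/

section CoeffBound

variable {n d : ℕ}

/-- Twice the exponent of `ω / n` belonging to a ribbon. -/
def Ribbon.spread (R : Ribbon n d) : ℝ := 2 * R.verts.card - R.left.card - R.right.card

/-- The amount by which the norm of the graph matrix of a ribbon can exceed the bound for a proper
ribbon whose two ends are minimum separators, as an exponent of `n ^ (1 / 4)`. -/
noncomputable def Ribbon.defect (R : Ribbon n d) : ℝ :=
  R.left.card + R.right.card + 2 * R.isolated.card - 2 * R.sep

lemma Ribbon.spread_nonneg (R : Ribbon n d) : 0 ≤ R.spread := by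
  have h1 : (R.left.card : ℝ) ≤ R.verts.card := by exact_mod_cast Finset.card_le_card R.left_subset
  have h2 : (R.right.card : ℝ) ≤ R.verts.card := by
    exact_mod_cast Finset.card_le_card R.right_subset
  unfold Ribbon.spread
  linarith

lemma Ribbon.spread_flip (R : Ribbon n d) : R.flip.spread = R.spread := by
  simp only [Ribbon.spread, Ribbon.flip]; ring

lemma IsMiddleFactor.card_left {R : Ribbon n d} (h : IsMiddleFactor R) : R.left.card = R.sep :=
  h.1.1.card_eq

lemma IsMiddleFactor.card_right {R : Ribbon n d} (h : IsMiddleFactor R) : R.right.card = R.sep :=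
  h.2.1.1.card_eq

lemma IsMiddleFactor.defect_eq {R : Ribbon n d} (h : IsMiddleFactor R) : R.defect = 0 := by
  have h3 : R.isolated = ∅ := by
    rw [Finset.eq_empty_iff_forall_notMem]
    intro v hv
    rw [mem_isolated] at hv
    obtain ⟨e, he, hve⟩ := h.2.2 v hv.1 hv.2.1 hv.2.2.1
    exact hv.2.2.2 e he hve
  rw [Ribbon.defect, h.card_left, h.card_right, h3]
  simp; ring

lemma IsLeftFactor.card_right_le {R : Ribbon n d} (h : IsLeftFactor R) :
    R.right.card ≤ R.left.card :=
  h.1.1.2.2 _ R.left_subset separates_left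

lemma IsStep.defect_le {L M R M' : Ribbon n d} (h : IsStep L M R M') :
    M'.defect ≤ M.defect + 2 * excess L M R M' := by
  have h1 : ((M'.left.card + M'.right.card + M.sep + M'.isolated.card + M'.verts.card : ℕ) : ℝ) ≤
      ((M'.sep + M.isolated.card + L.verts.card + M.verts.card + R.verts.card : ℕ) : ℝ) :=
    Nat.cast_le.2 h.tradeoff
  have h2 := h.leftFactor.card_right_le
  have h3 := (isLeftFactor_flip h.rightFactor).card_right_le
  change R.left.card ≤ R.right.card at h3
  rw [h.composable.1, h.left_eq] at h2
  rw [← h.composable.2, h.right_eq] at h3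
  have h2' : (M.left.card : ℝ) ≤ M'.left.card := Nat.cast_le.2 h2
  have h3' : (M.right.card : ℝ) ≤ M'.right.card := Nat.cast_le.2 h3
  push_cast at h1
  simp only [Ribbon.defect, excess]
  push_cast
  linarith

lemma IsStep.spread_eq {L M R M' : Ribbon n d} (h : IsStep L M R M') :
    M.spread = M'.spread + 2 * excess L M R M' - L.spread - R.spread := by
  simp only [Ribbon.spread, excess, h.composable.1, ← h.composable.2, h.left_eq, h.right_eq]
  push_cast
  ring

lemma exp_neg_spread_le (τ : ℕ) (R : Ribbon n d) :
    Real.exp (-(Real.log 2 * τ * R.spread)) ≤ factorWeight τ R := by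
  have hl := Real.log_pos (one_lt_two)
  have h1 : (R.left.card : ℝ) ≤ R.verts.card := by exact_mod_cast Finset.card_le_card R.left_subset
  have h2 := Finset.card_le_card R.right_subset
  have h3 : factorWeight τ R = Real.exp (-(Real.log 2 * (τ * (R.verts.card - R.right.card)))) := by
    rw [factorWeight, Real.exp_neg, Real.exp_mul, Real.exp_log two_pos, ← Nat.cast_sub h2,
      ← Nat.cast_mul, Real.rpow_natCast]
  rw [h3, Real.exp_le_exp, neg_le_neg_iff, mul_assoc]
  refine mul_le_mul_of_nonneg_left (mul_le_mul_of_nonneg_left ?_ (Nat.cast_nonneg τ)) hl.le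
  unfold Ribbon.spread
  linarith

/-- The coefficients decay by a factor `n ^ (-ε / 2)` in each step of the recursion; the defect of
the ribbon is paid for by intersections, and the number of triples by a small part of the
gain from intersections and spread. Here `l` stands for `log n`. -/
theorem abs_coeff_le {ε l q : ℝ} {τ : ℕ} (hl : 0 ≤ l) (hq : q = Real.exp (-((1 / 2 + ε) * l)))
    (hτ : 14 * Real.log 2 * τ ≤ ε * l) (i : ℕ) (R : Ribbon n d) (hR : R.verts.card ≤ τ) :
    |coeff q i R| ≤
      Real.exp (-(l / 4 * R.defect) - ε * l / 2 * i + Real.log 2 * τ * R.spread) := by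
  classical
  have hlog := Real.log_pos (one_lt_two)
  induction i generalizing R with
  | zero =>
    simp only [coeff]
    split_ifs with h
    · rw [h.defect_eq, abs_one, Real.one_le_exp_iff]
      have := mul_nonneg (mul_nonneg hlog.le (Nat.cast_nonneg (α := ℝ) τ)) R.spread_nonneg
      simp only [Nat.cast_zero]
      linarith
    · rw [abs_zero]; positivity
  | succ i ih =>
    rw [coeff_succ]
    -- the last summand leaves the factor `2 ^ (-5 τ)` that pays for the `32 ^ τ` triples
    set K := Real.exp (-(l / 4 * R.defect) - ε * l / 2 * i + Real.log 2 * τ * R.spread +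
      (-(ε * l / 2) - 5 * Real.log 2 * τ)) with hK
    have hterm : ∀ L M R' : Ribbon n d,
        |if IsStep L M R' R then coeff q i M * q ^ excess L M R' R else 0| ≤
          K * if IsStep L M R' R then factorWeight τ L * factorWeight τ R'.flip else 0 := by
      intro L M R'
      split_ifs with h
      swap
      · simp
      have hM : M.verts.card ≤ τ :=
        (Finset.card_le_card fun v hv => h.mem_verts_iff.2 (Or.inr (Or.inl hv))).trans hR
      have hr : (1 : ℝ) ≤ excess L M R' R := by exact_mod_cast h.one_le_excess
      have h1 := h.defect_le
      have h2 := h.spread_eq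
      have hqr : q ^ excess L M R' R = Real.exp (-((1 / 2 + ε) * l) * excess L M R' R) := by
        rw [hq, Real.exp_mul, Real.rpow_intCast]
      rw [abs_mul, hqr, abs_of_pos (Real.exp_pos _)]
      calc _ ≤ Real.exp (-(l / 4 * M.defect) - ε * l / 2 * i + Real.log 2 * τ * M.spread) *
              Real.exp (-((1 / 2 + ε) * l) * excess L M R' R) :=
            mul_le_mul_of_nonneg_right (ih M hM) (Real.exp_pos _).le
        _ ≤ K * (Real.exp (-(Real.log 2 * τ * L.spread)) *
              Real.exp (-(Real.log 2 * τ * R'.flip.spread))) := by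
            rw [hK, ← Real.exp_add, ← Real.exp_add, ← Real.exp_add, Real.exp_le_exp, h2,
              Ribbon.spread_flip]
            have h3 : l / 4 * R.defect ≤ l / 4 * (M.defect + 2 * excess L M R' R) :=
              mul_le_mul_of_nonneg_left h1 (by positivity)
            have h4 : 0 ≤ (ε * l - 2 * Real.log 2 * τ) * ((excess L M R' R : ℝ) - 1) := by
              refine mul_nonneg ?_ (by linarith)
              have := mul_nonneg hlog.le (Nat.cast_nonneg (α := ℝ) τ)
              linarith
            linarith
        _ ≤ K * (factorWeight τ L * factorWeight τ R'.flip) := by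
            refine mul_le_mul_of_nonneg_left ?_ (Real.exp_pos _).le
            exact mul_le_mul (exp_neg_spread_le τ L) (exp_neg_spread_le τ R'.flip)
              (Real.exp_pos _).le (factorWeight_nonneg _ _)
    calc _ ≤ ∑ L : Ribbon n d, ∑ M : Ribbon n d, ∑ R' : Ribbon n d,
          |if IsStep L M R' R then coeff q i M * q ^ excess L M R' R else 0| := by
          refine (Finset.abs_sum_le_sum_abs _ _).trans (Finset.sum_le_sum fun L _ => ?_)
          refine (Finset.abs_sum_le_sum_abs _ _).trans (Finset.sum_le_sum fun M _ => ?_)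
          exact Finset.abs_sum_le_sum_abs _ _
      _ ≤ ∑ L : Ribbon n d, ∑ M : Ribbon n d, ∑ R' : Ribbon n d,
          K * if IsStep L M R' R then factorWeight τ L * factorWeight τ R'.flip else 0 :=
          Finset.sum_le_sum fun L _ => Finset.sum_le_sum fun M _ =>
            Finset.sum_le_sum fun R' _ => hterm L M R'
      _ ≤ K * 32 ^ τ := by
          simp only [← Finset.mul_sum]
          exact mul_le_mul_of_nonneg_left (sum_triples_le R hR) (Real.exp_pos _).le
      _ = _ := by
          have h32 : (32 : ℝ) ^ τ = Real.exp (5 * Real.log 2 * τ) := by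
            rw [show 5 * Real.log 2 * τ = Real.log 2 * ((5 * τ : ℕ) : ℝ) by push_cast; ring,
              Real.exp_mul, Real.exp_log two_pos, Real.rpow_natCast, pow_mul]
            norm_num
          rw [h32, hK, ← Real.exp_add]
          congr 1
          push_cast
          ring

end CoeffBound

/-! ### Chains of ribbons and powers of ribbon matrices -/

section Chains

variable {n d : ℕ}

/-- Consecutive ribbons of the sequence share an end; the first one starts at `S` and the last one
ends at `T`. -/
def IsChain : (k : ℕ) → Finset (Fin n) → (Fin k → Ribbon n d) → Finset (Fin n) → Prop
  | 0, S, _, T => S = T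
  | k + 1, S, ρ, T => (ρ 0).left = S ∧ IsChain k (ρ 0).right (Fin.tail ρ) T

lemma IsChain.right_eq_left {k : ℕ} {S T : Finset (Fin n)} {ρ : Fin k → Ribbon n d}
    (h : IsChain k S ρ T) {i j : Fin k} (hij : i.val + 1 = j.val) :
    (ρ i).right = (ρ j).left := by
  induction k generalizing S with
  | zero => exact i.elim0
  | succ k ih =>
    obtain ⟨-, h⟩ := h
    obtain ⟨j', rfl⟩ : ∃ j', j = Fin.succ j' := by
      refine Fin.exists_succ_eq.2 ?_ |>.imp fun _ h => h.symm
      rintro rfl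
      simp at hij
    rcases Fin.eq_zero_or_eq_succ i with rfl | ⟨i', rfl⟩
    · simp only [Fin.val_zero, Fin.val_succ, zero_add] at hij
      cases k with
      | zero => exact j'.elim0
      | succ k =>
        have : j' = 0 := Fin.ext (by simp only [Fin.val_zero]; omega)
        rw [this]
        exact h.1.symm
    · exact ih h (i := i') (j := j') (by simpa using hij)

/-- The matrix with entries `∑ a(R) χ_R(G)`, the sum being over the ribbons with the given ends. -/
noncomputable def ribbonMatrix (a : Ribbon n d → ℝ) (G : SimpleGraph (Fin n)) :
    Matrix (SmallSet n d) (SmallSet n d) ℝ :=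
  Matrix.of fun S T => ∑ R : Ribbon n d, if R.left = S.1 ∧ R.right = T.1 then a R * chi R G else 0

lemma sum_fin_succ {X : Type*} [Fintype X] {k : ℕ} (f : (Fin (k + 1) → X) → ℝ) :
    ∑ ρ, f ρ = ∑ x : X, ∑ ρ : Fin k → X, f (Fin.cons x ρ) := by
  rw [← (Fin.consEquiv fun _ => X).sum_comp, Fintype.sum_prod_type]
  rfl

open Classical in
lemma ribbonMatrix_pow (a : Ribbon n d → ℝ) (G : SimpleGraph (Fin n)) (k : ℕ)
    (S T : SmallSet n d) : (ribbonMatrix a G ^ k) S T =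
      ∑ ρ : Fin k → Ribbon n d, if IsChain k S.1 ρ T.1 then ∏ j, (a (ρ j) * chi (ρ j) G) else 0 := by
  induction k generalizing S with
  | zero =>
    simp only [pow_zero, IsChain, Finset.univ_unique, Finset.sum_singleton, Finset.univ_eq_empty,
      Finset.prod_empty, Matrix.one_apply, Subtype.ext_iff]
  | succ k ih =>
    rw [pow_succ', Matrix.mul_apply, sum_fin_succ]
    simp only [ih]
    simp only [ribbonMatrix, Matrix.of_apply, Finset.sum_mul]
    rw [Finset.sum_comm]
    refine Finset.sum_congr rfl fun R _ => ?_
    rw [Finset.sum_eq_single (⟨R.right, R.card_right⟩ : SmallSet n d)]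
    · simp only [IsChain, Fin.cons_zero, Fin.tail_cons, Fin.prod_univ_succ, Fin.cons_succ,
        and_true, ite_mul, zero_mul, Finset.mul_sum]
      by_cases h : R.left = S.1
      · simp only [h, if_true, true_and, mul_ite, mul_zero]
      · simp only [h, if_false, false_and, Finset.sum_const_zero]
    · intro S' _ hS'
      rw [if_neg, zero_mul]
      rintro ⟨-, h⟩
      exact hS' (Subtype.ext h.symm)
    · exact fun h => absurd (Finset.mem_univ _) h

/-- All pairs belong to an even number of the ribbons. -/
def EvenEdges {k : ℕ} (ρ : Fin k → Ribbon n d) : Prop :=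
  ∀ e : Sym2 (Fin n), Even (Finset.univ.filter fun j => e ∈ (ρ j).edges).card

/-- The graph obtained by changing the status of the pair `e`. -/
def toggleGraph (e : Sym2 (Fin n)) (G : SimpleGraph (Fin n)) : SimpleGraph (Fin n) :=
  SimpleGraph.fromEdgeSet (symmDiff G.edgeSet {e})

lemma mem_toggleGraph {e : Sym2 (Fin n)} {G : SimpleGraph (Fin n)} {f : Sym2 (Fin n)}
    (hf : ¬ f.IsDiag) : f ∈ (toggleGraph e G).edgeSet ↔ (f = e ↔ f ∉ G.edgeSet) := by
  rw [toggleGraph, SimpleGraph.edgeSet_fromEdgeSet, Set.mem_sdiff, Set.mem_symmDiff,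
    Set.mem_singleton_iff]
  have : f ∉ Sym2.diagSet := fun h => hf (Sym2.mem_diagSet.1 h)
  tauto

lemma toggleGraph_toggleGraph (e : Sym2 (Fin n)) (G : SimpleGraph (Fin n)) :
    toggleGraph e (toggleGraph e G) = G := by
  rw [← SimpleGraph.edgeSet_inj]
  ext f
  by_cases hf : f.IsDiag
  · exact ⟨fun h => absurd hf (SimpleGraph.not_isDiag_of_mem_edgeSet _ h),
      fun h => absurd hf (SimpleGraph.not_isDiag_of_mem_edgeSet _ h)⟩
  · rw [mem_toggleGraph hf, mem_toggleGraph hf]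
    tauto

lemma chi_toggleGraph (R : Ribbon n d) (e : Sym2 (Fin n)) (G : SimpleGraph (Fin n)) :
    chi R (toggleGraph e G) = (if e ∈ R.edges then -1 else 1) * chi R G := by
  classical
  have h1 : (if e ∈ R.edges then (-1 : ℝ) else 1) = ∏ f ∈ R.edges, if f = e then -1 else 1 := by
    rw [Finset.prod_ite_eq']
  rw [h1, chi, chi, ← Finset.prod_mul_distrib]
  refine Finset.prod_congr rfl fun f hf => ?_
  have := mem_toggleGraph (e := e) (G := G) (R.not_isDiag f hf)
  by_cases c1 : f = e <;> by_cases c2 : f ∈ G.edgeSet <;> simp_all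

lemma abs_chi (R : Ribbon n d) (G : SimpleGraph (Fin n)) : |chi R G| = 1 := by
  classical
  rw [chi, Finset.abs_prod]
  refine Finset.prod_eq_one fun e _ => ?_
  split_ifs <;> simp

open Classical in
/-- A product of characters averages to zero unless every pair occurs an even number of times. -/
lemma sum_prod_chi_eq_zero {k : ℕ} {ρ : Fin k → Ribbon n d} (h : ¬ EvenEdges ρ) :
    ∑ G : SimpleGraph (Fin n), ∏ j, chi (ρ j) G = 0 := by
  rw [EvenEdges] at h
  push Not at h
  obtain ⟨e, he⟩ := h
  let φ : SimpleGraph (Fin n) ≃ SimpleGraph (Fin n) :=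
    ⟨toggleGraph e, toggleGraph e, toggleGraph_toggleGraph e, toggleGraph_toggleGraph e⟩
  have h1 : ∑ G : SimpleGraph (Fin n), ∏ j, chi (ρ j) G =
      ∑ G : SimpleGraph (Fin n), -∏ j, chi (ρ j) G := by
    rw [← φ.sum_comp]
    refine Finset.sum_congr rfl fun G _ => ?_
    change ∏ j, chi (ρ j) (toggleGraph e G) = _
    simp only [chi_toggleGraph, Finset.prod_mul_distrib]
    rw [Finset.prod_ite, Finset.prod_const, Finset.prod_const_one, mul_one,
      (Nat.not_even_iff_odd.1 (by convert he)).neg_one_pow, neg_one_mul]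
  rw [Finset.sum_neg_distrib] at h1
  linarith

open Classical in
/-- The expected trace of a power is at most the weighted number of closed chains in which every
pair occurs an even number of times. -/
lemma sum_trace_le (a : Ribbon n d → ℝ) (k : ℕ) :
    ∑ G : SimpleGraph (Fin n), (ribbonMatrix a G ^ k).trace ≤
      Fintype.card (SimpleGraph (Fin n)) * ∑ S : SmallSet n d, ∑ ρ : Fin k → Ribbon n d,
        if IsChain k S.1 ρ S.1 ∧ EvenEdges ρ then ∏ j, |a (ρ j)| else 0 := by
  simp only [Matrix.trace, Matrix.diag_apply, ribbonMatrix_pow]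
  rw [Finset.sum_comm, Finset.mul_sum]
  refine Finset.sum_le_sum fun S _ => ?_
  rw [Finset.sum_comm, Finset.mul_sum]
  refine Finset.sum_le_sum fun ρ _ => ?_
  by_cases h1 : IsChain k S.1 ρ S.1
  swap
  · simp only [h1, if_false, false_and, Finset.sum_const_zero, mul_zero, le_refl]
  simp only [h1, if_true, true_and, Finset.prod_mul_distrib]
  rw [← Finset.mul_sum]
  split_ifs with h2
  · refine (le_abs_self _).trans ?_
    rw [abs_mul, Finset.abs_prod, mul_comm]
    refine mul_le_mul_of_nonneg_right ?_ (Finset.prod_nonneg fun _ _ => abs_nonneg _)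
    refine (Finset.abs_sum_le_sum_abs _ _).trans_eq ?_
    simp only [Finset.abs_prod, abs_chi, Finset.prod_const_one, Finset.sum_const, nsmul_eq_mul,
      mul_one, Finset.card_univ]
  · rw [sum_prod_chi_eq_zero h2, mul_zero, mul_zero]

end Chains

/-! ### The number of vertices of a chain -/

section Support

variable {n d k : ℕ}

/-- The vertices that occur in a sequence of ribbons. -/
def support (ρ : Fin k → Ribbon n d) : Finset (Fin n) := Finset.univ.biUnion fun j => (ρ j).verts

lemma mem_support {ρ : Fin k → Ribbon n d} {v : Fin n} :
    v ∈ support ρ ↔ ∃ j, v ∈ (ρ j).verts := by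
  simp [support]

/-- The vertices of the `j`-th ribbon that do not occur earlier in the sequence. -/
def firsts (ρ : Fin k → Ribbon n d) (j : Fin k) : Finset (Fin n) :=
  (ρ j).verts.filter fun v => ∀ i, i < j → v ∉ (ρ i).verts

/-- The vertices of the `j`-th ribbon that do not occur later in the sequence. -/
def lasts (ρ : Fin k → Ribbon n d) (j : Fin k) : Finset (Fin n) :=
  (ρ j).verts.filter fun v => ∀ i, j < i → v ∉ (ρ i).verts

lemma mem_firsts {ρ : Fin k → Ribbon n d} {j : Fin k} {v : Fin n} :
    v ∈ firsts ρ j ↔ v ∈ (ρ j).verts ∧ ∀ i, i < j → v ∉ (ρ i).verts := by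
  simp only [firsts, Finset.mem_filter]

lemma mem_lasts {ρ : Fin k → Ribbon n d} {j : Fin k} {v : Fin n} :
    v ∈ lasts ρ j ↔ v ∈ (ρ j).verts ∧ ∀ i, j < i → v ∉ (ρ i).verts := by
  simp only [lasts, Finset.mem_filter]

lemma card_support_le_firsts (ρ : Fin k → Ribbon n d) :
    (support ρ).card ≤ ∑ j, (firsts ρ j).card := by
  refine le_trans (Finset.card_le_card fun v hv => ?_) Finset.card_biUnion_le
  have hne : (Finset.univ.filter fun j => v ∈ (ρ j).verts).Nonempty := by
    obtain ⟨j, hj⟩ := mem_support.1 hv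
    exact ⟨j, by simpa using hj⟩
  refine Finset.mem_biUnion.2 ⟨Finset.min' _ hne, Finset.mem_univ _, mem_firsts.2 ⟨?_, ?_⟩⟩
  · exact (Finset.mem_filter.1 (Finset.min'_mem _ hne)).2
  · intro i hi hvi
    exact absurd (Finset.min'_le _ i (by simpa using hvi)) (not_le.2 hi)

lemma card_support_le_lasts (ρ : Fin k → Ribbon n d) :
    (support ρ).card ≤ ∑ j, (lasts ρ j).card := by
  refine le_trans (Finset.card_le_card fun v hv => ?_) Finset.card_biUnion_le
  have hne : (Finset.univ.filter fun j => v ∈ (ρ j).verts).Nonempty := by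
    obtain ⟨j, hj⟩ := mem_support.1 hv
    exact ⟨j, by simpa using hj⟩
  refine Finset.mem_biUnion.2 ⟨Finset.max' _ hne, Finset.mem_univ _, mem_lasts.2 ⟨?_, ?_⟩⟩
  · exact (Finset.mem_filter.1 (Finset.max'_mem _ hne)).2
  · intro i hi hvi
    exact absurd (Finset.le_max' _ i (by simpa using hvi)) (not_le.2 hi)

lemma EvenEdges.exists_ne {ρ : Fin k → Ribbon n d} (h : EvenEdges ρ) {e : Sym2 (Fin n)}
    {j : Fin k} (he : e ∈ (ρ j).edges) : ∃ i, i ≠ j ∧ e ∈ (ρ i).edges := by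
  have hj : j ∈ Finset.univ.filter fun j => e ∈ (ρ j).edges := by simpa using he
  have h1 : 1 < (Finset.univ.filter fun j => e ∈ (ρ j).edges).card := by
    have h2 : 0 < (Finset.univ.filter fun j => e ∈ (ρ j).edges).card := Finset.card_pos.2 ⟨j, hj⟩
    obtain ⟨c, hc⟩ := h e
    omega
  obtain ⟨i, hi, hij⟩ := Finset.exists_mem_ne h1 j
  exact ⟨i, hij, by simpa using hi⟩

/-- In an inner ribbon of a chain, an edge cannot join a vertex that occurs for the first time to
one that occurs for the last time, since the edge occurs in another ribbon as well. Hence the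
vertices that are neither separate the two ends. -/
lemma card_firsts_add_lasts_le {ρ : Fin k → Ribbon n d} (h : EvenEdges ρ) {i j l : Fin k}
    (hij : i < j) (hjl : j < l) (h1 : (ρ j).left ⊆ (ρ i).verts)
    (h2 : (ρ j).right ⊆ (ρ l).verts) :
    (firsts ρ j).card + (lasts ρ j).card + (ρ j).sep ≤
      (ρ j).verts.card + (ρ j).isolated.card := by
  have hsub : firsts ρ j ∪ lasts ρ j ⊆ (ρ j).verts :=
    Finset.union_subset (Finset.filter_subset _ _) (Finset.filter_subset _ _)
  have hsep : (ρ j).sep ≤ ((ρ j).verts \ (firsts ρ j ∪ lasts ρ j)).card := by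
    refine sepNum_le Finset.sdiff_subset ?_
    refine separates_of_closed (fun v => v ∈ lasts ρ j) ?_ ?_ ?_
    · intro v hv hvS
      have hvj := (ρ j).left_subset hv
      have : v ∉ firsts ρ j := fun h' => (mem_firsts.1 h').2 i hij (h1 hv)
      simp only [Finset.mem_sdiff, Finset.mem_union, not_and, not_not] at hvS
      exact (hvS hvj).resolve_left this
    · intro u v hu _ he hvS
      have hvj := (ρ j).mem_verts _ he v (by simp)
      simp only [Finset.mem_sdiff, Finset.mem_union, not_and, not_not] at hvS
      refine (hvS hvj).resolve_left fun hv => ?_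
      obtain ⟨m, hm, hem⟩ := h.exists_ne he
      rcases lt_or_gt_of_ne hm with hm | hm
      · exact (mem_firsts.1 hv).2 m hm ((ρ m).mem_verts _ hem v (by simp))
      · exact (mem_lasts.1 hu).2 m hm ((ρ m).mem_verts _ hem u (by simp))
    · exact fun v hv _ h' => (mem_lasts.1 h').2 l hjl (h2 hv)
  have hiso : (firsts ρ j ∩ lasts ρ j).card ≤ (ρ j).isolated.card := by
    refine Finset.card_le_card fun v hv => ?_
    obtain ⟨hf, hl⟩ := Finset.mem_inter.1 hv
    refine mem_isolated.2 ⟨(mem_firsts.1 hf).1, fun h' => (mem_firsts.1 hf).2 i hij (h1 h'),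
      fun h' => (mem_lasts.1 hl).2 l hjl (h2 h'), fun e he hve => ?_⟩
    obtain ⟨m, hm, hem⟩ := h.exists_ne he
    rcases lt_or_gt_of_ne hm with hm | hm
    · exact (mem_firsts.1 hf).2 m hm ((ρ m).mem_verts _ hem v hve)
    · exact (mem_lasts.1 hl).2 m hm ((ρ m).mem_verts _ hem v hve)
  have h3 := Finset.card_union_add_card_inter (firsts ρ j) (lasts ρ j)
  have h4 := Finset.card_sdiff_of_subset hsub
  have h5 := Finset.card_le_card hsub
  omega

/-- A chain in which every pair occurs an even number of times has few vertices: counted twice,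
an inner ribbon contributes at most its number of vertices, minus the size of a minimum
separator, plus the number of isolated vertices. -/
theorem two_mul_card_support_le {τ : ℕ} {S T : Finset (Fin n)} {ρ : Fin k → Ribbon n d}
    (hc : IsChain k S ρ T) (h : EvenEdges ρ) (hτ : ∀ j, (ρ j).verts.card ≤ τ) :
    2 * (support ρ).card + ∑ j, (ρ j).sep ≤
      ∑ j, ((ρ j).verts.card + (ρ j).isolated.card) + 4 * τ := by
  have key : ∀ j : Fin k, (firsts ρ j).card + (lasts ρ j).card + (ρ j).sep ≤
      (ρ j).verts.card + (ρ j).isolated.card +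
        ((if j.val = 0 then 2 * τ else 0) + (if j.val + 1 = k then 2 * τ else 0)) := by
    intro j
    -- the first and the last ribbon are estimated trivially
    by_cases hj : j.val = 0 ∨ j.val + 1 = k
    · have h1 : (firsts ρ j).card ≤ (ρ j).verts.card :=
        Finset.card_le_card (Finset.filter_subset _ _)
      have h2 : (lasts ρ j).card ≤ (ρ j).verts.card :=
        Finset.card_le_card (Finset.filter_subset _ _)
      have h3 : (ρ j).sep ≤ (ρ j).verts.card :=
        (sepNum_le (ρ j).left_subset separates_left).trans
          (Finset.card_le_card (ρ j).left_subset)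
      have h4 := hτ j
      have h5 : 2 * τ ≤ (if j.val = 0 then 2 * τ else 0) + (if j.val + 1 = k then 2 * τ else 0) := by
        split_ifs <;> omega
      omega
    · push Not at hj
      have hjk := j.isLt
      let i : Fin k := ⟨j.val - 1, by omega⟩
      let l : Fin k := ⟨j.val + 1, by omega⟩
      have hi : i.val + 1 = j.val := by simp only [i]; omega
      have h1 : (ρ j).left ⊆ (ρ i).verts := hc.right_eq_left hi ▸ (ρ i).right_subset
      have h2 : (ρ j).right ⊆ (ρ l).verts :=
        (hc.right_eq_left (i := j) (j := l) rfl).symm ▸ (ρ l).left_subset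
      have := card_firsts_add_lasts_le h (i := i) (j := j) (l := l)
        (Fin.lt_def.2 (by omega)) (Fin.lt_def.2 (by simp only [l]; omega)) h1 h2
      omega
  have hend : ∑ j : Fin k, ((if j.val = 0 then 2 * τ else 0) +
      (if j.val + 1 = k then 2 * τ else 0)) ≤ 4 * τ := by
    have aux : ∀ p : Fin k → Prop, ∀ [DecidablePred p], (∀ i j, p i → p j → i = j) →
        ∑ j : Fin k, (if p j then 2 * τ else 0) ≤ 2 * τ := by
      intro p _ hp
      rw [← Finset.sum_filter, Finset.sum_const, smul_eq_mul]
      have : (Finset.univ.filter p).card ≤ 1 := Finset.card_le_one.2 fun i hi j hj =>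
        hp i j (Finset.mem_filter.1 hi).2 (Finset.mem_filter.1 hj).2
      nlinarith
    rw [Finset.sum_add_distrib]
    have e1 := aux (fun j => j.val = 0) fun i j hi hj => Fin.ext (hi.trans hj.symm)
    have e2 := aux (fun j => j.val + 1 = k) fun i j hi hj => Fin.ext (by omega)
    omega
  have hsum := Finset.sum_le_sum fun j (_ : j ∈ Finset.univ) => key j
  rw [Finset.sum_add_distrib, Finset.sum_add_distrib, Finset.sum_add_distrib] at hsum
  have h1 := card_support_le_firsts ρ
  have h2 := card_support_le_lasts ρ
  omega

end Support

/-! ### The trace bound -/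

section TraceBound

variable {n d k : ℕ}

/-- The size of the coefficient of a ribbon, relative to the norm of its graph matrix; `l` stands
for `log n`. -/
noncomputable def normWeight (a : Ribbon n d → ℝ) (l : ℝ) (R : Ribbon n d) : ℝ :=
  |a R| * Real.exp (l / 2 * ((R.verts.card : ℝ) + R.isolated.card - R.sep))

lemma normWeight_nonneg (a : Ribbon n d → ℝ) (l : ℝ) (R : Ribbon n d) : 0 ≤ normWeight a l R :=
  mul_nonneg (abs_nonneg _) (Real.exp_pos _).le

open Classical in
/-- The weights of the chains inside `U` that start at `S` are bounded by a power of the row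
sums. -/
lemma sum_chain_le {w : Ribbon n d → ℝ} (hw : ∀ R, 0 ≤ w R) {r : ℝ} (hr : 0 ≤ r)
    {U : Finset (Fin n)}
    (hrow : ∀ S, ∑ R : Ribbon n d, (if R.left = S ∧ R.verts ⊆ U then w R else 0) ≤ r)
    (k : ℕ) (S T : Finset (Fin n)) :
    ∑ ρ : Fin k → Ribbon n d,
      (if IsChain k S ρ T ∧ ∀ j, (ρ j).verts ⊆ U then ∏ j, w (ρ j) else 0) ≤ r ^ k := by
  induction k generalizing S with
  | zero =>
    simp only [Finset.univ_unique, Finset.sum_singleton, Finset.univ_eq_empty, Finset.prod_empty,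
      pow_zero]
    split_ifs <;> norm_num
  | succ k ih =>
    rw [sum_fin_succ]
    calc _ ≤ ∑ R : Ribbon n d, (if R.left = S ∧ R.verts ⊆ U then w R else 0) * r ^ k := by
          refine Finset.sum_le_sum fun R _ => ?_
          simp only [IsChain, Fin.cons_zero, Fin.tail_cons, Fin.prod_univ_succ, Fin.cons_succ,
            Fin.forall_fin_succ]
          by_cases h : R.left = S ∧ R.verts ⊆ U
          · rw [if_pos h]
            simp only [h.1, h.2, true_and]
            refine le_trans (le_of_eq ?_) (mul_le_mul_of_nonneg_left (ih R.right) (hw R))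
            rw [Finset.mul_sum]
            exact Finset.sum_congr rfl fun ρ _ => by rw [mul_ite, mul_zero]
          · rw [if_neg h, zero_mul]
            refine (Finset.sum_eq_zero fun ρ _ => if_neg ?_).le
            rintro ⟨⟨h1, -⟩, h2, -⟩
            exact h ⟨h1, h2⟩
      _ ≤ r ^ (k + 1) := by
          rw [← Finset.sum_mul, pow_succ']
          exact mul_le_mul_of_nonneg_right (hrow S) (pow_nonneg hr k)

lemma sum_inv_pow_card_le (hn : 0 < n) :
    ∑ U : Finset (Fin n), ((n : ℝ)⁻¹) ^ U.card ≤ 3 := by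
  have h1 := Finset.prod_one_add (f := fun _ : Fin n => (n : ℝ)⁻¹) Finset.univ
  simp only [Finset.prod_const, Finset.card_univ, Fintype.card_fin, Finset.powerset_univ] at h1
  rw [← h1]
  have hn' : (0 : ℝ) < n := by exact_mod_cast hn
  calc (1 + (n : ℝ)⁻¹) ^ n ≤ Real.exp ((n : ℝ)⁻¹) ^ n := by
        refine pow_le_pow_left₀ (by positivity) ?_ n
        rw [add_comm]
        exact Real.add_one_le_exp _
    _ = Real.exp 1 := by rw [← Real.exp_nat_mul, mul_inv_cancel₀ hn'.ne']
    _ ≤ 3 := by linarith [Real.exp_one_lt_d9]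

lemma IsChain.left_subset_support {S T : Finset (Fin n)} {ρ : Fin k → Ribbon n d}
    (h : IsChain k S ρ T) (hk : 0 < k) : S ⊆ support ρ := by
  obtain ⟨k, rfl⟩ := Nat.exists_eq_succ_of_ne_zero hk.ne'
  rw [← h.1]
  exact fun v hv => mem_support.2 ⟨0, (ρ 0).left_subset hv⟩

/-- The weight of a chain with even edges, in terms of the norm weights of its ribbons. -/
lemma prod_abs_le (a : Ribbon n d → ℝ) {τ : ℕ} {l : ℝ} (hl : 0 ≤ l)
    {S T : Finset (Fin n)} {ρ : Fin k → Ribbon n d} (hc : IsChain k S ρ T) (he : EvenEdges ρ)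
    (hτ : ∀ j, (ρ j).verts.card ≤ τ) :
    ∏ j, |a (ρ j)| ≤ Real.exp (2 * l * τ) *
      (Real.exp (-l * (support ρ).card) * ∏ j, normWeight a l (ρ j)) := by
  have h1 : ((2 * (support ρ).card + ∑ j, (ρ j).sep : ℕ) : ℝ) ≤
      ((∑ j, ((ρ j).verts.card + (ρ j).isolated.card) + 4 * τ : ℕ) : ℝ) :=
    Nat.cast_le.2 (two_mul_card_support_le hc he hτ)
  push_cast at h1
  have h2 : ∑ j, l / 2 * (((ρ j).verts.card : ℝ) + (ρ j).isolated.card - (ρ j).sep) =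
      l / 2 * (∑ j, (((ρ j).verts.card : ℝ) + (ρ j).isolated.card) - ∑ j, ((ρ j).sep : ℝ)) := by
    rw [← Finset.mul_sum, Finset.sum_sub_distrib]
  simp only [normWeight]
  rw [Finset.prod_mul_distrib, ← Real.exp_sum, h2,
    mul_left_comm (Real.exp (-l * _)), mul_left_comm (Real.exp (2 * l * τ)),
    ← Real.exp_add, ← Real.exp_add]
  refine le_mul_of_one_le_right (Finset.prod_nonneg fun _ _ => abs_nonneg _) ?_
  rw [Real.one_le_exp_iff]
  have h3 := mul_le_mul_of_nonneg_left h1 (show 0 ≤ l / 2 by positivity)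
  linarith

open Classical in
/-- The trace method: the expected trace of a power of a ribbon matrix is controlled by the row
sums of the norm weights, restricted to ribbons inside a small set of vertices. -/
theorem sum_trace_ribbonMatrix_le (a : Ribbon n d → ℝ) {τ : ℕ} {r : ℝ} (hn : 0 < n) (hk : 0 < k)
    (ha : ∀ R, a R ≠ 0 → R.verts.card ≤ τ) (hr : 0 ≤ r)
    (hrow : ∀ U S : Finset (Fin n), U.card ≤ k * τ → ∑ R : Ribbon n d,
      (if R.left = S ∧ R.verts ⊆ U then normWeight a (Real.log n) R else 0) ≤ r) :
    ∑ G : SimpleGraph (Fin n), (ribbonMatrix a G ^ k).trace ≤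
      Fintype.card (SimpleGraph (Fin n)) *
        (3 * Real.exp (2 * Real.log n * τ) * (2 ^ (k * τ) * r ^ k)) := by
  set l := Real.log n with hl
  have hl0 : 0 ≤ l := Real.log_natCast_nonneg n
  refine (sum_trace_le a k).trans (mul_le_mul_of_nonneg_left ?_ (Nat.cast_nonneg _))
  set 𝒰 := (Finset.univ : Finset (Finset (Fin n))).filter fun U => U.card ≤ k * τ with h𝒰
  have hW : ∀ R, 0 ≤ normWeight a l R := normWeight_nonneg a l
  have hterm : ∀ (S : SmallSet n d) (ρ : Fin k → Ribbon n d),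
      (if IsChain k S.1 ρ S.1 ∧ EvenEdges ρ then ∏ j, |a (ρ j)| else 0) ≤
      Real.exp (2 * l * τ) * ∑ U ∈ 𝒰, Real.exp (-l * U.card) * (if S.1 ⊆ U then
        (if IsChain k S.1 ρ S.1 ∧ ∀ j, (ρ j).verts ⊆ U then ∏ j, normWeight a l (ρ j) else 0)
        else 0) := by
    intro S ρ
    have hterms : ∀ U ∈ 𝒰, 0 ≤ Real.exp (-l * U.card) * (if S.1 ⊆ U then
        (if IsChain k S.1 ρ S.1 ∧ ∀ j, (ρ j).verts ⊆ U then ∏ j, normWeight a l (ρ j) else 0)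
        else 0) := by
      intro U _
      refine mul_nonneg (Real.exp_pos _).le ?_
      split_ifs
      exacts [Finset.prod_nonneg fun j _ => hW _, le_rfl, le_rfl]
    split_ifs with h
    swap
    · exact mul_nonneg (Real.exp_pos _).le (Finset.sum_nonneg hterms)
    by_cases h0 : ∃ j, a (ρ j) = 0
    · obtain ⟨j, hj⟩ := h0
      rw [Finset.prod_eq_zero (Finset.mem_univ j) (by rw [hj, abs_zero])]
      exact mul_nonneg (Real.exp_pos _).le (Finset.sum_nonneg hterms)
    push Not at h0
    have hτ : ∀ j, (ρ j).verts.card ≤ τ := fun j => ha _ (h0 j)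
    have hmem : support ρ ∈ 𝒰 := by
      rw [h𝒰, Finset.mem_filter]
      refine ⟨Finset.mem_univ _, Finset.card_biUnion_le.trans ?_⟩
      refine (Finset.sum_le_sum fun j _ => hτ j).trans ?_
      simp
    refine (prod_abs_le a hl0 h.1 h.2 hτ).trans
      (mul_le_mul_of_nonneg_left ?_ (Real.exp_pos _).le)
    refine le_trans (le_of_eq ?_) (Finset.single_le_sum hterms hmem)
    rw [if_pos (h.1.left_subset_support hk),
      if_pos ⟨h.1, fun j v hv => mem_support.2 ⟨j, hv⟩⟩]
  have hU : ∀ U ∈ 𝒰, ∑ S : SmallSet n d, ∑ ρ : Fin k → Ribbon n d, (if S.1 ⊆ U then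
        (if IsChain k S.1 ρ S.1 ∧ ∀ j, (ρ j).verts ⊆ U then ∏ j, normWeight a l (ρ j) else 0)
        else 0) ≤ 2 ^ (k * τ) * r ^ k := by
    intro U hU
    have hUc : U.card ≤ k * τ := (Finset.mem_filter.1 hU).2
    calc _ ≤ ∑ S : SmallSet n d, (if S.1 ⊆ U then r ^ k else 0) := by
          refine Finset.sum_le_sum fun S _ => ?_
          split_ifs with hS
          · exact sum_chain_le hW hr (fun S' => hrow U S' hUc) k S.1 S.1
          · simp
      _ ≤ _ := by
          rw [← Finset.sum_filter, Finset.sum_const, nsmul_eq_mul]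
          refine mul_le_mul_of_nonneg_right ?_ (pow_nonneg hr k)
          have h1 : (Finset.univ.filter fun S : SmallSet n d => S.1 ⊆ U).card ≤ 2 ^ U.card := by
            rw [← Finset.card_powerset]
            refine Finset.card_le_card_of_injOn Subtype.val ?_ Subtype.val_injective.injOn
            intro S hS
            simpa using hS
          exact_mod_cast h1.trans (Nat.pow_le_pow_right two_pos hUc)
  calc _ ≤ ∑ S : SmallSet n d, ∑ ρ : Fin k → Ribbon n d, Real.exp (2 * l * τ) *
        ∑ U ∈ 𝒰, Real.exp (-l * U.card) * (if S.1 ⊆ U then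
          (if IsChain k S.1 ρ S.1 ∧ ∀ j, (ρ j).verts ⊆ U then ∏ j, normWeight a l (ρ j) else 0)
          else 0) :=
        Finset.sum_le_sum fun S _ => Finset.sum_le_sum fun ρ _ => hterm S ρ
    _ = Real.exp (2 * l * τ) * ∑ U ∈ 𝒰, Real.exp (-l * U.card) *
          ∑ S : SmallSet n d, ∑ ρ : Fin k → Ribbon n d, (if S.1 ⊆ U then
          (if IsChain k S.1 ρ S.1 ∧ ∀ j, (ρ j).verts ⊆ U then ∏ j, normWeight a l (ρ j) else 0)
          else 0) := by
        simp only [← Finset.mul_sum]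
        congr 1
        rw [Finset.sum_congr rfl fun S _ => Finset.sum_comm, Finset.sum_comm]
        simp only [← Finset.mul_sum]
    _ ≤ Real.exp (2 * l * τ) * ∑ U ∈ 𝒰, Real.exp (-l * U.card) * (2 ^ (k * τ) * r ^ k) := by
        refine mul_le_mul_of_nonneg_left (Finset.sum_le_sum fun U hU' => ?_) (Real.exp_pos _).le
        exact mul_le_mul_of_nonneg_left (hU U hU') (Real.exp_pos _).le
    _ ≤ Real.exp (2 * l * τ) * (3 * (2 ^ (k * τ) * r ^ k)) := by
        refine mul_le_mul_of_nonneg_left ?_ (Real.exp_pos _).le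
        rw [← Finset.sum_mul]
        refine mul_le_mul_of_nonneg_right ?_ (mul_nonneg (by positivity) (pow_nonneg hr k))
        refine le_trans ?_ (sum_inv_pow_card_le hn)
        refine (Finset.sum_le_sum_of_subset_of_nonneg (Finset.subset_univ 𝒰)
          fun _ _ _ => (Real.exp_pos _).le).trans_eq (Finset.sum_congr rfl fun U _ => ?_)
        rw [mul_comm, Real.exp_nat_mul, Real.exp_neg, hl, Real.exp_log (by exact_mod_cast hn)]
    _ = _ := by ring

end TraceBound

/-! ### Row sums of the norm weights -/

section RowSum

variable {n d : ℕ}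

open Classical in
/-- Ribbons with a given first end and given vertices, without edges inside the first end. -/
lemma card_ribbons_left_le (S V : Finset (Fin n)) (hS : S ⊆ V) :
    (Finset.univ.filter fun R : Ribbon n d => R.left = S ∧ R.verts = V ∧
      ∀ e ∈ R.edges, ∃ v ∈ e, v ∉ S).card ≤ 2 ^ V.card * 2 ^ ((V.card - S.card) * V.card) := by
  rw [Finset.card_eq_sum_card_fiberwise (f := fun R => R.right) (t := V.powerset)]
  · rw [← Finset.card_powerset, ← smul_eq_mul, ← Finset.sum_const]
    refine Finset.sum_le_sum fun T _ => ?_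
    refine le_trans (Finset.card_le_card fun R hR => ?_) (card_ribbons_le (d := d) S T V S hS)
    rw [Finset.mem_filter, Finset.mem_filter] at hR
    rw [Finset.mem_filter]
    exact ⟨Finset.mem_univ _, hR.1.2.1, hR.2, hR.1.2.2⟩
  · intro R hR
    obtain ⟨-, h, -⟩ := (Finset.mem_filter.1 hR).2
    exact Finset.mem_powerset.2 (h ▸ R.right_subset)

open Classical in
/-- If the weights decrease geometrically in the number of vertices outside the first end, so fast
that they beat both the number of edge sets and the number of choices of these vertices in `U`,
then the row sums are at most `3 * 2 ^ τ` times the bound `A` for the smallest ribbons. -/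
lemma row_sum_le {w : Ribbon n d → ℝ} {A θ : ℝ} (hA : 0 ≤ A) (hθ : 0 ≤ θ)
    {τ m : ℕ} (hwτ : ∀ R, w R ≠ 0 → R.verts.card ≤ τ ∧ ∀ e ∈ R.edges, ∃ v ∈ e, v ∉ R.left)
    (hwA : ∀ R, w R ≤ A * θ ^ (R.verts.card - R.left.card)) (hm : θ * 2 ^ τ * m ≤ 1)
    {U S : Finset (Fin n)} (hU : U.card ≤ m) :
    ∑ R : Ribbon n d, (if R.left = S ∧ R.verts ⊆ U then w R else 0) ≤ 3 * A * 2 ^ τ := by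
  set 𝒱 := Finset.univ.filter fun V : Finset (Fin n) => S ⊆ V ∧ V ⊆ U ∧ V.card ≤ τ with h𝒱
  set y := θ * 2 ^ τ with hy
  have hy0 : 0 ≤ y := by positivity
  have h1 : ∑ R : Ribbon n d, (if R.left = S ∧ R.verts ⊆ U then w R else 0) ≤
      ∑ V ∈ 𝒱, ∑ R ∈ Finset.univ.filter fun R : Ribbon n d => R.left = S ∧ R.verts = V ∧
        ∀ e ∈ R.edges, ∃ v ∈ e, v ∉ S, A * θ ^ (V.card - S.card) := by
    have h2 : ∀ R : Ribbon n d, (if R.left = S ∧ R.verts ⊆ U then w R else 0) ≤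
        ∑ V ∈ 𝒱, if R.left = S ∧ R.verts = V ∧ ∀ e ∈ R.edges, ∃ v ∈ e, v ∉ S
          then A * θ ^ (V.card - S.card) else 0 := by
      intro R
      have h0 : ∀ V ∈ 𝒱, 0 ≤ if R.left = S ∧ R.verts = V ∧ ∀ e ∈ R.edges, ∃ v ∈ e, v ∉ S
          then A * θ ^ (V.card - S.card) else 0 := by
        intro V _
        split_ifs
        · positivity
        · exact le_rfl
      split_ifs with h
      swap
      · exact Finset.sum_nonneg h0
      by_cases hR : w R = 0
      · rw [hR]
        exact Finset.sum_nonneg h0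
      obtain ⟨h3, h4⟩ := hwτ R hR
      have hmem : R.verts ∈ 𝒱 := by
        rw [h𝒱, Finset.mem_filter]
        exact ⟨Finset.mem_univ _, h.1 ▸ R.left_subset, h.2, h3⟩
      refine le_trans ?_ (Finset.single_le_sum h0 hmem)
      rw [if_pos ⟨h.1, rfl, h.1 ▸ h4⟩, ← h.1]
      exact hwA R
    refine (Finset.sum_le_sum fun R _ => h2 R).trans_eq ?_
    rw [Finset.sum_comm]
    exact Finset.sum_congr rfl fun V _ => (Finset.sum_filter _ _).symm
  refine h1.trans ?_
  calc _ ≤ ∑ V ∈ 𝒱, A * 2 ^ τ * y ^ (V.card - S.card) := by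
        refine Finset.sum_le_sum fun V hV => ?_
        obtain ⟨-, hSV, -, hVτ⟩ := Finset.mem_filter.1 hV
        rw [Finset.sum_const, nsmul_eq_mul]
        have h2 := card_ribbons_left_le (d := d) S V hSV
        have h3 : 2 ^ V.card * 2 ^ ((V.card - S.card) * V.card) ≤
            2 ^ τ * (2 ^ τ) ^ (V.card - S.card) := by
          rw [← pow_mul]
          refine Nat.mul_le_mul (Nat.pow_le_pow_right two_pos hVτ)
            (Nat.pow_le_pow_right two_pos ?_)
          rw [mul_comm]
          exact Nat.mul_le_mul_right _ hVτ
        have h4 := Nat.cast_le (α := ℝ).2 (h2.trans h3)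
        push_cast at h4
        refine (mul_le_mul_of_nonneg_right h4 (by positivity)).trans_eq ?_
        rw [hy, mul_pow]
        ring
    _ = A * 2 ^ τ * ∑ V ∈ 𝒱, y ^ (V \ S).card := by
        rw [Finset.mul_sum]
        refine Finset.sum_congr rfl fun V hV => ?_
        rw [Finset.card_sdiff_of_subset (Finset.mem_filter.1 hV).2.1]
    _ ≤ A * 2 ^ τ * ∑ X ∈ (U \ S).powerset, y ^ X.card := by
        refine mul_le_mul_of_nonneg_left ?_ (by positivity)
        rw [← Finset.sum_image (f := fun X => y ^ X.card) (g := fun V => V \ S) (s := 𝒱)]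
        · refine Finset.sum_le_sum_of_subset_of_nonneg ?_ fun X _ _ => by positivity
          intro X hX
          obtain ⟨V, hV, rfl⟩ := Finset.mem_image.1 hX
          exact Finset.mem_powerset.2
            (Finset.sdiff_subset_sdiff (Finset.mem_filter.1 hV).2.2.1 le_rfl)
        · intro V hV V' hV' h
          have e1 := (Finset.mem_filter.1 hV).2.1
          have e2 := (Finset.mem_filter.1 hV').2.1
          rw [← Finset.sdiff_union_of_subset e1, ← Finset.sdiff_union_of_subset e2]
          exact congrArg (· ∪ S) h
    _ = A * 2 ^ τ * (1 + y) ^ (U \ S).card := by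
        rw [← Finset.prod_const, Finset.prod_one_add]
        simp only [Finset.prod_const]
    _ ≤ A * 2 ^ τ * 3 := by
        refine mul_le_mul_of_nonneg_left ?_ (by positivity)
        have hc : (U \ S).card ≤ m := (Finset.card_le_card Finset.sdiff_subset).trans hU
        calc (1 + y) ^ (U \ S).card ≤ Real.exp y ^ (U \ S).card := by
              refine pow_le_pow_left₀ (by positivity) ?_ _
              rw [add_comm]
              exact Real.add_one_le_exp y
          _ ≤ Real.exp y ^ m := pow_le_pow_right₀ (Real.one_le_exp hy0) hc
          _ = Real.exp (y * m) := by rw [mul_comm, Real.exp_nat_mul]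
          _ ≤ Real.exp 1 := Real.exp_le_exp.2 hm
          _ ≤ 3 := by linarith [Real.exp_one_lt_d9]
    _ = 3 * A * 2 ^ τ := by ring

end RowSum

/-! ### Splitting off the edges inside the ends -/

section Clean

variable {n d : ℕ}

/-- The pairs of distinct vertices that lie inside `S` or inside `T`. -/
def endPairs (S T : Finset (Fin n)) : Finset (Sym2 (Fin n)) :=
  pairsIn Finset.univ S ∪ pairsIn Finset.univ T

lemma mem_endPairs {S T : Finset (Fin n)} {e : Sym2 (Fin n)} : e ∈ endPairs S T ↔
    ¬ e.IsDiag ∧ ((∀ v ∈ e, v ∈ S) ∨ (∀ v ∈ e, v ∈ T)) := by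
  simp only [endPairs, Finset.mem_union, mem_pairsIn, Finset.mem_univ, true_and]
  exact and_or_left.symm

lemma card_pairsIn_univ (S : Finset (Fin n)) : (pairsIn Finset.univ S).card = S.card.choose 2 := by
  rw [← Sym2.card_image_offDiag]
  congr 1
  ext e
  induction e with
  | _ u v =>
    simp only [mem_pairsIn, Finset.mem_univ, true_and, Sym2.mk_isDiag_iff, Finset.mem_image,
      Finset.mem_offDiag, Prod.exists, Sym2.mem_iff, forall_eq_or_imp, forall_eq]
    constructor
    · rintro ⟨h1, h2, h3⟩
      exact ⟨u, v, ⟨h2, h3, h1⟩, rfl⟩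
    · rintro ⟨a, b, ⟨h1, h2, h3⟩, h4⟩
      rcases Sym2.eq_iff.1 h4 with ⟨rfl, rfl⟩ | ⟨rfl, rfl⟩
      · exact ⟨h3, h1, h2⟩
      · exact ⟨Ne.symm h3, h2, h1⟩

lemma card_endPairs (S T : Finset (Fin n)) :
    (endPairs S T).card + (S ∩ T).card.choose 2 = S.card.choose 2 + T.card.choose 2 := by
  have h : pairsIn Finset.univ S ∩ pairsIn Finset.univ T = pairsIn Finset.univ (S ∩ T) := by
    ext e
    simp only [mem_pairsIn, Finset.mem_inter, Finset.mem_univ, true_and]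
    grind
  rw [← card_pairsIn_univ S, ← card_pairsIn_univ T, ← card_pairsIn_univ (S ∩ T), ← h, endPairs]
  exact Finset.card_union_add_card_inter _ _

/-- No edge of the ribbon lies inside one of its ends. -/
def IsClean (R : Ribbon n d) : Prop := ∀ e ∈ R.edges, e ∉ endPairs R.left R.right

lemma pairsIn_eq_self {W : Finset (Sym2 (Fin n))} {R : Ribbon n d}
    (hW : W ⊆ endPairs R.left R.right) : pairsIn W R.verts = W := by
  ext e
  rw [mem_pairsIn]
  refine ⟨fun h => h.1, fun h => ⟨h, ?_⟩⟩
  obtain ⟨h1, h2⟩ := mem_endPairs.1 (hW h)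
  refine ⟨h1, h2.elim (fun h2 v hv => R.left_subset (h2 v hv)) fun h2 v hv =>
    R.right_subset (h2 v hv)⟩

lemma toggle_edges_of_subset {W : Finset (Sym2 (Fin n))} {R : Ribbon n d}
    (hW : W ⊆ endPairs R.left R.right) : (R.toggle W).edges = symmDiff R.edges W := by
  change symmDiff R.edges (pairsIn W R.verts) = _
  rw [pairsIn_eq_self hW]

lemma coeff_toggle_right (q : ℝ) (i : ℕ) (R : Ribbon n d) {X : Finset (Sym2 (Fin n))}
    (hX : ∀ e ∈ X, ∀ v ∈ e, v ∈ R.right) : coeff q i (R.toggle X) = coeff q i R := by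
  have h := coeff_toggle_left q i R.flip (X := X) hX
  rw [coeff_flip] at h
  rw [← h, ← coeff_flip]
  rfl

lemma coeff_toggle (q : ℝ) (i : ℕ) (R : Ribbon n d) {W : Finset (Sym2 (Fin n))}
    (hW : W ⊆ endPairs R.left R.right) : coeff q i (R.toggle W) = coeff q i R := by
  set W₁ := W.filter fun e => ∀ v ∈ e, v ∈ R.left with hW₁
  set W₂ := W.filter fun e => ¬ ∀ v ∈ e, v ∈ R.left with hW₂
  have h1 : R.toggle W = (R.toggle W₁).toggle W₂ := by
    refine Ribbon.ext rfl rfl rfl ?_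
    rw [toggle_edges_of_subset hW,
      toggle_edges_of_subset (R := R.toggle W₁) ((Finset.filter_subset _ _).trans hW),
      toggle_edges_of_subset ((Finset.filter_subset _ _).trans hW), symmDiff_assoc]
    congr 1
    rw [Disjoint.symmDiff_eq_sup (Finset.disjoint_filter_filter_not _ _ _)]
    exact (Finset.filter_union_filter_not_eq _ _).symm
  rw [h1, coeff_toggle_right, coeff_toggle_left]
  · exact fun e he => (Finset.mem_filter.1 he).2
  · intro e he
    obtain ⟨h2, h3⟩ := Finset.mem_filter.1 he
    exact (mem_endPairs.1 (hW h2)).2.resolve_left h3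

open Classical in
lemma chi_toggle {R : Ribbon n d} (hR : IsClean R) {W : Finset (Sym2 (Fin n))}
    (hW : W ⊆ endPairs R.left R.right) (G : SimpleGraph (Fin n)) :
    chi (R.toggle W) G = chi R G * ∏ e ∈ W, (if e ∈ G.edgeSet then 1 else -1) := by
  have hd : Disjoint R.edges W := Finset.disjoint_left.2 fun e he hW' => hR e he (hW hW')
  rw [chi, chi, toggle_edges_of_subset hW, hd.symmDiff_eq_sup, Finset.sup_eq_union,
    Finset.prod_union hd]

open Classical in
/-- The characters of the edge sets inside the two ends sum up to the indicator of the event that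
both ends are cliques, times the number of these sets. -/
lemma sum_endPairs (S T : Finset (Fin n)) (G : SimpleGraph (Fin n)) :
    ∑ W ∈ (endPairs S T).powerset, ∏ e ∈ W, (if e ∈ G.edgeSet then (1 : ℝ) else -1) =
      if G.IsClique (S : Set (Fin n)) ∧ G.IsClique (T : Set (Fin n))
      then 2 ^ (endPairs S T).card else 0 := by
  rw [← Finset.prod_one_add]
  have hclique : (G.IsClique (S : Set (Fin n)) ∧ G.IsClique (T : Set (Fin n))) ↔
      ∀ e ∈ endPairs S T, e ∈ G.edgeSet := by
    constructor
    · rintro ⟨hS, hT⟩ e he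
      induction e with
      | _ u v =>
        obtain ⟨h1, h2⟩ := mem_endPairs.1 he
        rw [Sym2.mk_isDiag_iff] at h1
        rw [SimpleGraph.mem_edgeSet]
        rcases h2 with h2 | h2
        · exact hS (h2 u (by simp)) (h2 v (by simp)) h1
        · exact hT (h2 u (by simp)) (h2 v (by simp)) h1
    · intro h
      refine ⟨fun u hu v hv huv => ?_, fun u hu v hv huv => ?_⟩
      · refine (SimpleGraph.mem_edgeSet G).1 (h s(u, v) (mem_endPairs.2 ⟨by simpa using huv, ?_⟩))
        exact Or.inl fun w hw => by rcases Sym2.mem_iff.1 hw with rfl | rfl <;> assumption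
      · refine (SimpleGraph.mem_edgeSet G).1 (h s(u, v) (mem_endPairs.2 ⟨by simpa using huv, ?_⟩))
        exact Or.inr fun w hw => by rcases Sym2.mem_iff.1 hw with rfl | rfl <;> assumption
  split_ifs with h
  · rw [hclique] at h
    rw [← Finset.prod_const]
    refine Finset.prod_congr rfl fun e he => ?_
    rw [if_pos (h e he)]
    norm_num
  · rw [hclique] at h
    push Not at h
    obtain ⟨e, he, heG⟩ := h
    refine Finset.prod_eq_zero he ?_
    rw [if_neg heG]
    norm_num

open Classical in
/-- Every ribbon arises from a clean one by adding edges inside the ends. -/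
lemma sum_ribbons_eq (S T : Finset (Fin n)) (f : Ribbon n d → ℝ) :
    ∑ R ∈ Finset.univ.filter (fun R : Ribbon n d => R.left = S ∧ R.right = T), f R =
      ∑ R ∈ Finset.univ.filter (fun R : Ribbon n d => (R.left = S ∧ R.right = T) ∧ IsClean R),
        ∑ W ∈ (endPairs S T).powerset, f (R.toggle W) := by
  rw [← Finset.sum_product']
  symm
  refine Finset.sum_nbij' (fun x => x.1.toggle x.2)
    (fun R => (R.toggle (R.edges ∩ endPairs S T), R.edges ∩ endPairs S T)) ?_ ?_ ?_ ?_ ?_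
  · rintro ⟨R, W⟩ hx
    rw [Finset.mem_product, Finset.mem_filter] at hx
    rw [Finset.mem_filter]
    exact ⟨Finset.mem_univ _, hx.1.2.1⟩
  · intro R hR
    obtain ⟨-, rfl, rfl⟩ := Finset.mem_filter.1 hR
    rw [Finset.mem_product, Finset.mem_filter, Finset.mem_powerset]
    refine ⟨⟨Finset.mem_univ _, ⟨rfl, rfl⟩, ?_⟩, Finset.inter_subset_right⟩
    intro e he
    rw [toggle_edges_of_subset Finset.inter_subset_right, Finset.mem_symmDiff,
      Finset.mem_inter] at he
    change e ∉ endPairs R.left R.right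
    tauto
  · rintro ⟨R, W⟩ hx
    rw [Finset.mem_product, Finset.mem_filter, Finset.mem_powerset] at hx
    obtain ⟨⟨-, ⟨rfl, rfl⟩, hc⟩, hW⟩ := hx
    simp only at hc hW
    have : (R.toggle W).edges ∩ endPairs R.left R.right = W := by
      rw [toggle_edges_of_subset hW]
      ext e
      rw [Finset.mem_inter, Finset.mem_symmDiff]
      have h1 := hc e
      have h2 := @hW e
      tauto
    simp only [this, Ribbon.toggle_toggle]
  · intro R _
    exact Ribbon.toggle_toggle _ R
  · exact fun _ _ => rfl

end Clean

/-! ### The matrices after removal of the edges inside the ends -/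

section Normalised

variable {n d : ℕ}

open Classical in
/-- The square root of a diagonal entry of `D`. -/
noncomputable def cliqueRoot (G : SimpleGraph (Fin n)) (S : Finset (Fin n)) : ℝ :=
  if G.IsClique (S : Set (Fin n)) then Real.exp (Real.log 2 * (S.card.choose 2 / 2)) / 2 else 0

/-- The exponent of `2` that remains of the number of edge sets inside the two ends after
division by the square roots of the entries of `D`; the pairs inside both ends count once among the
edge sets, but twice in the product of the two square roots. -/
noncomputable def Ribbon.gain (R : Ribbon n d) : ℝ :=
  (R.left.card.choose 2 + R.right.card.choose 2) / 2 - (R.left ∩ R.right).card.choose 2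

open Classical in
/-- The coefficients of the normalised matrix `N` with `Q = D ^ (1 / 2) * N * D ^ (1 / 2)`: the
ribbons that differ only inside the ends are collected in the clean one among them, and the power
of `ω / n` is part of the coefficient. -/
noncomputable def cleanCoeff (q : ℝ) (τ i : ℕ) (R : Ribbon n d) : ℝ :=
  if IsClean R ∧ R.verts.card ≤ τ
  then 4 * Real.exp (Real.log 2 * R.gain) * coeff q i R * q ^ (R.spread / 2) else 0

open Classical in
lemma cliqueRoot_mul (G : SimpleGraph (Fin n)) (R : Ribbon n d) :
    cliqueRoot G R.left * (4 * Real.exp (Real.log 2 * R.gain)) * cliqueRoot G R.right =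
      if G.IsClique (R.left : Set (Fin n)) ∧ G.IsClique (R.right : Set (Fin n))
      then 2 ^ (endPairs R.left R.right).card else 0 := by
  have h : ((endPairs R.left R.right).card : ℝ) + (R.left ∩ R.right).card.choose 2 =
      R.left.card.choose 2 + R.right.card.choose 2 := by
    exact_mod_cast card_endPairs R.left R.right
  have h2 : (2 : ℝ) ^ (endPairs R.left R.right).card =
      Real.exp (Real.log 2 * (R.left.card.choose 2 / 2)) * Real.exp (Real.log 2 * R.gain) *
        Real.exp (Real.log 2 * (R.right.card.choose 2 / 2)) := by
    rw [← Real.exp_add, ← Real.exp_add, ← Real.rpow_natCast, Real.rpow_def_of_pos two_pos,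
      Ribbon.gain]
    congr 1
    linear_combination Real.log 2 * h
  rw [cliqueRoot, cliqueRoot, h2]
  by_cases hS : G.IsClique (R.left : Set (Fin n)) <;>
    by_cases hT : G.IsClique (R.right : Set (Fin n)) <;>
    simp only [hS, hT, if_true, if_false, and_self, and_false, false_and, zero_mul, mul_zero]
  ring

lemma cliqueRoot_mul_self (G : SimpleGraph (Fin n)) :
    Matrix.diagonal (fun S : SmallSet n d => cliqueRoot G S.1) *
      Matrix.diagonal (fun S : SmallSet n d => cliqueRoot G S.1) = D d G := by
  classical
  rw [Matrix.diagonal_mul_diagonal, D]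
  congr 1
  ext S
  rw [cliqueRoot]
  split_ifs with h
  · rw [div_mul_div_comm, ← Real.exp_add, ← Real.rpow_natCast, Real.rpow_def_of_pos two_pos]
    congr 2 <;> ring
  · rw [zero_mul]

lemma Q_eq_diagonal_mul (q : ℝ) (τ : ℕ) (G : SimpleGraph (Fin n)) (i : ℕ) :
    Q d q τ G i = Matrix.diagonal (fun S : SmallSet n d => cliqueRoot G S.1) *
      ribbonMatrix (cleanCoeff q τ i) G *
        Matrix.diagonal (fun S : SmallSet n d => cliqueRoot G S.1) := by
  classical
  ext S T
  rw [Matrix.mul_diagonal, Matrix.diagonal_mul, Q, qMatrix, ribbonMatrix, Matrix.of_apply,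
    Matrix.of_apply]
  set g : Ribbon n d → ℝ := fun R => if R.verts.card ≤ τ
    then coeff q i R * q ^ (R.spread / 2) * chi R G else 0 with hg
  calc _ = ∑ R ∈ Finset.univ.filter (fun R : Ribbon n d => R.left = S.1 ∧ R.right = T.1), g R := by
        rw [Finset.sum_filter]
        refine Finset.sum_congr rfl fun R _ => ?_
        by_cases h : R.left = S.1 ∧ R.right = T.1
        · have h3 : (R.verts.card : ℝ) - ((S.1.card : ℝ) + (T.1.card : ℝ)) / 2 = R.spread / 2 := by
            rw [Ribbon.spread, h.1, h.2]
            ring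
          simp only [h.1, h.2, true_and, and_self, if_true, hg, h3]
        · rw [if_neg h, if_neg fun h' => h ⟨h'.1, h'.2.1⟩]
    _ = ∑ R ∈ Finset.univ.filter (fun R : Ribbon n d =>
          (R.left = S.1 ∧ R.right = T.1) ∧ IsClean R),
          g R * (cliqueRoot G R.left * (4 * Real.exp (Real.log 2 * R.gain)) *
            cliqueRoot G R.right) := by
        rw [sum_ribbons_eq]
        refine Finset.sum_congr rfl fun R hR => ?_
        obtain ⟨-, ⟨hS, hT⟩, hc⟩ := Finset.mem_filter.1 hR
        rw [cliqueRoot_mul, ← sum_endPairs, ← hS, ← hT, Finset.mul_sum]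
        refine Finset.sum_congr rfl fun W hW => ?_
        have hW' := Finset.mem_powerset.1 hW
        simp only [hg]
        rw [coeff_toggle q i R hW', chi_toggle hc hW']
        change (if R.verts.card ≤ τ then
          coeff q i R * q ^ (R.spread / 2) * (chi R G * _) else 0) = _
        split_ifs
        · ring
        · ring
    _ = _ := by
        rw [Finset.sum_filter, Finset.mul_sum, Finset.sum_mul]
        refine Finset.sum_congr rfl fun R _ => ?_
        by_cases h : R.left = S.1 ∧ R.right = T.1
        · rw [← h.1, ← h.2]
          by_cases hc : IsClean R <;> by_cases hτ : R.verts.card ≤ τ <;>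
            simp only [hg, hc, hτ, cleanCoeff, and_true, and_false, if_true, if_false,
              zero_mul, mul_zero]
          ring
        · simp only [h, false_and, if_false, mul_zero, zero_mul]

lemma choose_two_sub_le {s a τ : ℕ} (has : a ≤ s) (hs : s ≤ τ) :
    (s.choose 2 : ℝ) - a.choose 2 ≤ τ * (s - a) := by
  rw [Nat.cast_choose_two, Nat.cast_choose_two]
  have h1 : (a : ℝ) ≤ s := Nat.cast_le.2 has
  have h2 : (s : ℝ) ≤ τ := Nat.cast_le.2 hs
  nlinarith [Nat.cast_nonneg (α := ℝ) a]

lemma Ribbon.gain_le {R : Ribbon n d} {τ : ℕ} (hτ : R.verts.card ≤ τ) :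
    R.gain ≤ τ * R.spread / 2 := by
  have hl := Finset.card_le_card R.left_subset
  have hr := Finset.card_le_card R.right_subset
  have h1 := choose_two_sub_le (Finset.card_le_card (Finset.inter_subset_left (s₁ := R.left)
    (s₂ := R.right))) (hl.trans hτ)
  have h2 := choose_two_sub_le (Finset.card_le_card (Finset.inter_subset_right (s₁ := R.left)
    (s₂ := R.right))) (hr.trans hτ)
  have h3 : ((R.left ∪ R.right).card : ℝ) + (R.left ∩ R.right).card =
      R.left.card + R.right.card := by
    exact_mod_cast Finset.card_union_add_card_inter R.left R.right
  have h4 : ((R.left ∪ R.right).card : ℝ) ≤ R.verts.card := by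
    exact_mod_cast Finset.card_le_card (Finset.union_subset R.left_subset R.right_subset)
  have h5 : (0 : ℝ) ≤ τ := Nat.cast_nonneg τ
  rw [Ribbon.gain, Ribbon.spread]
  nlinarith

lemma Ribbon.card_sub_le_spread (R : Ribbon n d) :
    ((R.verts.card - R.left.card : ℕ) : ℝ) ≤ R.spread := by
  rw [Nat.cast_sub (Finset.card_le_card R.left_subset), Ribbon.spread]
  have : (R.right.card : ℝ) ≤ R.verts.card := by exact_mod_cast Finset.card_le_card R.right_subset
  linarith

/-- The norm weights of the normalised coefficients are small, except for the ribbons without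
edges whose two ends both are the whole vertex set, for `i = 0`. -/
lemma normWeight_cleanCoeff_le {ε l q : ℝ} {τ : ℕ} (hl : 0 ≤ l) (hε : 0 ≤ ε)
    (hq : q = Real.exp (-((1 / 2 + ε) * l))) (hτ : 30 * Real.log 2 * τ ≤ ε * l) {i : ℕ}
    {R : Ribbon n d} (hi : 1 ≤ i ∨ 1 ≤ R.spread) :
    normWeight (cleanCoeff q τ i) l R ≤
      4 * Real.exp (-(ε * l / 4)) * Real.exp (-(ε * l / 5)) ^ (R.verts.card - R.left.card) := by
  have hlog := Real.log_pos (one_lt_two)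
  have hετ : 0 ≤ Real.log 2 * τ := by positivity
  have hεl : 0 ≤ ε * l := mul_nonneg hε hl
  rw [normWeight, cleanCoeff]
  split_ifs with h
  swap
  · rw [abs_zero, zero_mul]
    positivity
  have hc := abs_coeff_le hl hq (by linarith) i R h.2
  have hg := mul_le_mul_of_nonneg_left (Ribbon.gain_le h.2) hlog.le
  have hqs : q ^ (R.spread / 2) = Real.exp (-((1 / 2 + ε) * l) * (R.spread / 2)) := by
    rw [hq, ← Real.exp_mul]
  have hs := R.spread_nonneg
  have hsub := R.card_sub_le_spread
  rw [abs_mul, abs_mul, abs_of_pos (a := 4 * _) (by positivity), hqs,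
    abs_of_pos (a := Real.exp (_ * (R.spread / 2))) (Real.exp_pos _)]
  calc _ ≤ 4 * Real.exp (Real.log 2 * R.gain) *
        Real.exp (-(l / 4 * R.defect) - ε * l / 2 * i + Real.log 2 * τ * R.spread) *
        Real.exp (-((1 / 2 + ε) * l) * (R.spread / 2)) *
        Real.exp (l / 2 * ((R.verts.card : ℝ) + R.isolated.card - R.sep)) := by gcongr
    _ = 4 * Real.exp (Real.log 2 * R.gain + Real.log 2 * τ * R.spread - ε * l * (i + R.spread) / 2)
        := by
        simp only [mul_assoc, ← Real.exp_add]
        congr 2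
        rw [Ribbon.defect, Ribbon.spread]
        ring
    _ ≤ 4 * Real.exp (-(ε * l / 4) + (R.verts.card - R.left.card : ℕ) * (-(ε * l / 5))) := by
        refine mul_le_mul_of_nonneg_left (Real.exp_le_exp.2 ?_) (by norm_num)
        have h1 : ε * l / 4 ≤ ε * l * (i / 2 + R.spread / 4) := by
          have : (1 : ℝ) / 4 ≤ i / 2 + R.spread / 4 := by
            rcases hi with hi | hi
            · have : (1 : ℝ) ≤ i := by exact_mod_cast hi
              linarith
            · have : (0 : ℝ) ≤ i := Nat.cast_nonneg i
              linarith
          calc ε * l / 4 = ε * l * (1 / 4) := by ring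
            _ ≤ _ := mul_le_mul_of_nonneg_left this hεl
        have h2 := mul_le_mul_of_nonneg_right hτ hs
        have h3 := mul_le_mul_of_nonneg_left hsub hεl
        linarith
    _ = _ := by rw [Real.exp_add, Real.exp_nat_mul, mul_assoc]

end Normalised

/-! ### Positive semidefiniteness from the trace of a power -/

section Trace

variable {ι : Type*} [Fintype ι] [DecidableEq ι]

lemma posSemidef_add_of_trace_pow_le {N : Matrix ι ι ℝ} (hN : N.IsHermitian) {η : ℝ} (hη : 0 ≤ η)
    {k : ℕ} (hk : Even k) (hk0 : k ≠ 0) (h : (N ^ k).trace ≤ η ^ k) :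
    (η • (1 : Matrix ι ι ℝ) + N).PosSemidef := by
  set φ := Unitary.conjStarAlgAut ℝ (Matrix ι ι ℝ) hN.eigenvectorUnitary with hφ
  set Λ : Matrix ι ι ℝ := Matrix.diagonal hN.eigenvalues with hΛ
  have hspec : N = φ Λ := hN.spectral_theorem
  have htr : ∀ X, (φ X).trace = X.trace := by
    intro X
    rw [hφ, Unitary.conjStarAlgAut_apply, Matrix.trace_mul_cycle, Unitary.coe_star_mul_self,
      one_mul]
  have hpow : (N ^ k).trace = ∑ j, hN.eigenvalues j ^ k := by
    have h1 : N ^ k = φ (Λ ^ k) := by rw [map_pow, ← hspec]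
    rw [h1, htr, hΛ, Matrix.diagonal_pow, Matrix.trace_diagonal]
    rfl
  have hev : ∀ j, 0 ≤ η + hN.eigenvalues j := by
    intro j
    have h1 : hN.eigenvalues j ^ k ≤ η ^ k := by
      refine le_trans ?_ (hpow ▸ h)
      exact Finset.single_le_sum (f := fun j => hN.eigenvalues j ^ k)
        (fun j _ => hk.pow_nonneg _) (Finset.mem_univ j)
    rw [← hk.pow_abs] at h1
    have h2 := (pow_le_pow_iff_left₀ (abs_nonneg _) hη hk0).1 h1
    linarith [neg_abs_le (hN.eigenvalues j)]
  have hsum : η • (1 : Matrix ι ι ℝ) + N =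
      (hN.eigenvectorUnitary : Matrix ι ι ℝ) * Matrix.diagonal (fun j => η + hN.eigenvalues j) *
        (hN.eigenvectorUnitary : Matrix ι ι ℝ).conjTranspose := by
    have h1 : Matrix.diagonal (fun j => η + hN.eigenvalues j) = η • (1 : Matrix ι ι ℝ) + Λ := by
      rw [hΛ, ← Matrix.diagonal_one, ← Matrix.diagonal_smul, Matrix.diagonal_add]
      congr 1
      ext j
      simp
    rw [h1]
    have h2 : φ (η • (1 : Matrix ι ι ℝ) + Λ) = η • (1 : Matrix ι ι ℝ) + N := by
      rw [map_add, map_smul, map_one, ← hspec]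
    rw [← h2, hφ, Unitary.conjStarAlgAut_apply]
    rfl
  rw [hsum]
  exact (Matrix.PosSemidef.diagonal fun j => hev j).mul_mul_conjTranspose_same _

lemma posSemidef_sub_of_trace_pow_le {N : Matrix ι ι ℝ} (hN : N.IsHermitian) {η : ℝ} (hη : 0 ≤ η)
    {k : ℕ} (hk : Even k) (hk0 : k ≠ 0) (h : (N ^ k).trace ≤ η ^ k) :
    (η • (1 : Matrix ι ι ℝ) - N).PosSemidef := by
  rw [sub_eq_add_neg]
  exact posSemidef_add_of_trace_pow_le hN.neg hη hk hk0 (by rwa [hk.neg_pow])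

lemma trace_pow_nonneg {N : Matrix ι ι ℝ} (hN : N.IsHermitian) {k : ℕ} (hk : Even k) :
    0 ≤ (N ^ k).trace := by
  obtain ⟨m, rfl⟩ := hk
  have : N ^ (m + m) = (N ^ m).conjTranspose * N ^ m := by rw [(hN.pow m).eq, pow_add]
  rw [this]
  exact (Matrix.posSemidef_conjTranspose_mul_self _).trace_nonneg

end Trace

/-! ### The uniform random graph -/

section Probability

open MeasureTheory

variable {n : ℕ}

instance : IsProbabilityMeasure (halfGraph n) := by
  unfold halfGraph; infer_instance

lemma halfGraph_singleton (G : SimpleGraph (Fin n)) :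
    (halfGraph n).real {G} = (1 / 2) ^ (n.choose 2) := by
  classical
  have h1 : unitInterval.symm (⟨1 / 2, by norm_num, by norm_num⟩ : unitInterval) =
      ⟨1 / 2, by norm_num, by norm_num⟩ := by
    ext; norm_num [unitInterval.coe_symm_eq]
  have h2 : G.edgeSet.ncard ≤ (Nat.card (Fin n)).choose 2 := by
    rw [Nat.card_eq_fintype_card, ← SimpleGraph.coe_edgeFinset, Set.ncard_coe_finset]
    exact G.card_edgeFinset_le_card_choose_two
  rw [measureReal_def, halfGraph, SimpleGraph.binomialRandom_singleton, h1, ← pow_add,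
    Nat.add_sub_cancel' h2, ENNReal.toReal_pow, Nat.card_eq_fintype_card, Fintype.card_fin]
  rfl

instance : MeasurableSingletonClass (SimpleGraph (Fin n)) := by
  refine ⟨fun G => ?_⟩
  rw [← SimpleGraph.measurableEmbedding_edgeSet.measurableSet_image, Set.image_singleton]
  exact measurableSet_singleton _

lemma card_simpleGraph_mul :
    (Fintype.card (SimpleGraph (Fin n)) : ℝ) * (1 / 2) ^ (n.choose 2) = 1 := by
  have h := sum_measureReal_singleton (μ := halfGraph n) Finset.univ
  simp only [halfGraph_singleton, Finset.sum_const, nsmul_eq_mul, Finset.card_univ,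
    Finset.coe_univ, probReal_univ] at h
  exact h

/-- Markov's inequality for the uniform random graph. -/
lemma halfGraph_real_le {f : SimpleGraph (Fin n) → ℝ} (hf : ∀ G, 0 ≤ f G) {t B : ℝ} (ht : 0 < t)
    (hB : ∑ G, f G ≤ Fintype.card (SimpleGraph (Fin n)) * B) :
    (halfGraph n).real {G | t < f G} ≤ B / t := by
  classical
  have h1 : {G | t < f G} = ((Finset.univ.filter fun G => t < f G : Finset _) : Set _) := by
    ext G; simp
  rw [h1, ← sum_measureReal_singleton]
  simp only [halfGraph_singleton, Finset.sum_const, nsmul_eq_mul]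
  rw [le_div_iff₀ ht]
  have h2 : ((Finset.univ.filter fun G => t < f G).card : ℝ) * t ≤ ∑ G, f G := by
    rw [← nsmul_eq_mul, ← Finset.sum_const]
    refine (Finset.sum_le_sum fun G hG => (Finset.mem_filter.1 hG).2.le).trans ?_
    exact Finset.sum_le_sum_of_subset_of_nonneg (Finset.subset_univ _) fun G _ _ => hf G
  have h3 : (0 : ℝ) < (1 / 2) ^ (n.choose 2) := by positivity
  calc _ = ((Finset.univ.filter fun G => t < f G).card : ℝ) * t * (1 / 2) ^ (n.choose 2) := by ring
    _ ≤ Fintype.card (SimpleGraph (Fin n)) * B * (1 / 2) ^ (n.choose 2) :=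
        mul_le_mul_of_nonneg_right (h2.trans hB) h3.le
    _ = B * (Fintype.card (SimpleGraph (Fin n)) * (1 / 2) ^ (n.choose 2)) := by ring
    _ = B := by rw [card_simpleGraph_mul, mul_one]

end Probability

/-! ### The proper part of the matrices -/

section Proper

variable {n d : ℕ}

open Classical in
/-- The coefficients of the normalised matrix, without the edgeless ribbons whose ends both are the
whole vertex set in the case `i = 0`. -/
noncomputable def properCoeff (q : ℝ) (τ i : ℕ) (R : Ribbon n d) : ℝ :=
  if i = 0 ∧ R.left = R.verts ∧ R.right = R.verts then 0 else cleanCoeff q τ i R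

lemma properCoeff_flip (q : ℝ) (τ i : ℕ) (R : Ribbon n d) :
    properCoeff q τ i R.flip = properCoeff q τ i R := by
  classical
  have h1 : IsClean R.flip ↔ IsClean R := by
    simp only [IsClean, Ribbon.flip, endPairs, Finset.union_comm]
  have h2 : R.flip.gain = R.gain := by
    simp only [Ribbon.gain, Ribbon.flip, Finset.inter_comm, add_comm]
  rw [properCoeff, properCoeff, cleanCoeff, cleanCoeff, coeff_flip, R.spread_flip, h2]
  refine if_congr ?_ rfl (if_congr (and_congr h1 Iff.rfl) rfl rfl)
  change i = 0 ∧ R.right = R.verts ∧ R.left = R.verts ↔ _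
  tauto

lemma ribbonMatrix_isHermitian (q : ℝ) (τ i : ℕ) (G : SimpleGraph (Fin n)) :
    (ribbonMatrix (d := d) (properCoeff q τ i) G).IsHermitian := by
  classical
  ext S T
  rw [Matrix.conjTranspose_apply, star_trivial, ribbonMatrix, Matrix.of_apply, Matrix.of_apply,
    ← (flipEquiv n d).sum_comp]
  refine Finset.sum_congr rfl fun R _ => ?_
  change (if R.right = T.1 ∧ R.left = S.1 then properCoeff q τ i R.flip * chi R G else 0) = _
  rw [properCoeff_flip]
  exact if_congr and_comm rfl rfl

lemma isMiddleFactor_trivialRibbon (S : Finset (Fin n)) (hS : S.card ≤ d) :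
    IsMiddleFactor (trivialRibbon S hS) := by
  have h : IsMinSep S ∅ S S S := by
    refine ⟨subset_rfl, separates_left, fun P _ hP => Finset.card_le_card fun v hv => ?_⟩
    obtain ⟨u, hu, huP⟩ := hP v hv v hv .nil
    rw [SimpleGraph.Walk.support_nil, List.mem_singleton] at hu
    exact hu ▸ huP
  exact ⟨isLeftmostSep_left_iff.2 h, isRightmostSep_right_iff.2 h, fun v hv h1 => absurd hv h1⟩

open Classical in
lemma cleanCoeff_trivialRibbon (q : ℝ) {τ : ℕ} (S : Finset (Fin n)) (hS : S.card ≤ d)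
    (hτ : d ≤ τ) : cleanCoeff q τ 0 (trivialRibbon S hS) = 4 := by
  have h1 : IsClean (trivialRibbon S hS) := fun e he => absurd he (Finset.notMem_empty e)
  have h2 : (trivialRibbon S hS).gain = 0 := by
    simp only [Ribbon.gain, trivialRibbon, Finset.inter_self]; ring
  have h3 : (trivialRibbon S hS).spread = 0 := by
    simp only [Ribbon.spread, trivialRibbon]; ring
  have h4 : coeff q 0 (trivialRibbon S hS) = 1 := by
    rw [coeff]
    exact if_pos (isMiddleFactor_trivialRibbon S hS)
  rw [cleanCoeff, if_pos ⟨h1, hS.trans hτ⟩, h2, h3, h4]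
  simp

lemma ribbonMatrix_cleanCoeff_zero (q : ℝ) {τ : ℕ} (hτ : d ≤ τ) (G : SimpleGraph (Fin n)) :
    ribbonMatrix (d := d) (cleanCoeff q τ 0) G =
      (4 : ℝ) • (1 : Matrix _ _ ℝ) + ribbonMatrix (properCoeff q τ 0) G := by
  classical
  ext S T
  rw [Matrix.add_apply, Matrix.smul_apply, ribbonMatrix, ribbonMatrix, Matrix.of_apply,
    Matrix.of_apply, ← sub_eq_iff_eq_add, ← Finset.sum_sub_distrib]
  rw [Finset.sum_eq_single (trivialRibbon S.1 S.2)]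
  · have h1 : properCoeff q τ 0 (trivialRibbon S.1 S.2) = 0 := if_pos ⟨rfl, rfl, rfl⟩
    rw [h1, cleanCoeff_trivialRibbon q S.1 S.2 hτ, Matrix.one_apply]
    by_cases h : S = T
    · subst h
      simp [trivialRibbon, chi]
    · have h' : S.1 ≠ T.1 := fun h' => h (Subtype.ext h')
      simp [trivialRibbon, h, h']
  · intro R _ hR
    by_cases h : R.left = S.1 ∧ R.right = T.1
    · rw [if_pos h, if_pos h]
      by_cases h0 : R.left = R.verts ∧ R.right = R.verts
      · have hc : ¬ IsClean R := by
          intro hc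
          refine hR (Ribbon.ext h.1 ?_ ?_ ?_)
          · exact h0.2.trans (h0.1.symm.trans h.1)
          · exact h0.1.symm.trans h.1
          · refine Finset.eq_empty_of_forall_notMem fun e he => hc e he (mem_endPairs.2 ?_)
            exact ⟨R.not_isDiag e he, Or.inl fun v hv => h0.1 ▸ R.mem_verts e he v hv⟩
        rw [properCoeff, if_pos ⟨rfl, h0⟩, cleanCoeff, if_neg fun h => hc h.1, sub_self]
      · rw [properCoeff, if_neg fun h => h0 h.2, sub_self]
    · rw [if_neg h, if_neg h, sub_self]
  · exact fun h => absurd (Finset.mem_univ _) h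

lemma ribbonMatrix_cleanCoeff (q : ℝ) (τ : ℕ) {i : ℕ} (hi : 1 ≤ i) (G : SimpleGraph (Fin n)) :
    ribbonMatrix (d := d) (cleanCoeff q τ i) G = ribbonMatrix (properCoeff q τ i) G := by
  congr 1
  ext R
  rw [properCoeff, if_neg]
  exact fun h => by omega

lemma properCoeff_support {q : ℝ} {τ i : ℕ} {R : Ribbon n d} (h : properCoeff q τ i R ≠ 0) :
    R.verts.card ≤ τ ∧ ∀ e ∈ R.edges, ∃ v ∈ e, v ∉ R.left := by
  classical
  rw [properCoeff] at h
  split_ifs at h with h1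
  · exact absurd rfl h
  rw [cleanCoeff] at h
  split_ifs at h with h2
  · refine ⟨h2.2, fun e he => ?_⟩
    by_contra! h3
    exact h2.1 e he (mem_endPairs.2 ⟨R.not_isDiag e he, Or.inl h3⟩)
  · exact absurd rfl h

lemma normWeight_properCoeff_le {ε l q : ℝ} {τ : ℕ} (hl : 0 ≤ l) (hε : 0 ≤ ε)
    (hq : q = Real.exp (-((1 / 2 + ε) * l))) (hτ : 30 * Real.log 2 * τ ≤ ε * l) (i : ℕ)
    (R : Ribbon n d) :
    normWeight (properCoeff q τ i) l R ≤
      4 * Real.exp (-(ε * l / 4)) * Real.exp (-(ε * l / 5)) ^ (R.verts.card - R.left.card) := by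
  by_cases h : i = 0 ∧ R.left = R.verts ∧ R.right = R.verts
  · rw [normWeight, properCoeff, if_pos h, abs_zero, zero_mul]
    positivity
  · have h1 : normWeight (properCoeff q τ i) l R = normWeight (cleanCoeff q τ i) l R := by
      rw [normWeight, normWeight, properCoeff, if_neg h]
    rw [h1]
    refine normWeight_cleanCoeff_le hl hε hq hτ ?_
    rcases Nat.eq_zero_or_pos i with hi | hi
    · right
      have h2 : R.left.card + R.right.card + 1 ≤ 2 * R.verts.card := by
        have hl := Finset.card_le_card R.left_subset
        have hr := Finset.card_le_card R.right_subset
        by_contra hcon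
        refine h ⟨hi, Finset.eq_of_subset_of_card_le R.left_subset (by omega),
          Finset.eq_of_subset_of_card_le R.right_subset (by omega)⟩
      have h3 : ((R.left.card + R.right.card + 1 : ℕ) : ℝ) ≤ ((2 * R.verts.card : ℕ) : ℝ) :=
        Nat.cast_le.2 h2
      push_cast at h3
      rw [Ribbon.spread]
      linarith
    · exact Or.inl hi

/-- The expected trace of a power of the proper part is small. -/
lemma sum_trace_properCoeff_le {ε q : ℝ} {τ k : ℕ} (hn : 0 < n) (hk : 0 < k) (hε : 0 ≤ ε)
    (hq : q = Real.exp (-((1 / 2 + ε) * Real.log n)))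
    (hτ : 30 * Real.log 2 * τ ≤ ε * Real.log n)
    (hkτ : Real.exp (-(ε * Real.log n / 5)) * 2 ^ τ * (k * τ : ℕ) ≤ 1) (i : ℕ) :
    ∑ G : SimpleGraph (Fin n), (ribbonMatrix (d := d) (properCoeff q τ i) G ^ k).trace ≤
      Fintype.card (SimpleGraph (Fin n)) * (3 * Real.exp (2 * Real.log n * τ) *
        (2 ^ (k * τ) * (12 * Real.exp (-(ε * Real.log n / 4)) * 2 ^ τ) ^ k)) := by
  have hl : 0 ≤ Real.log n := Real.log_natCast_nonneg n
  refine sum_trace_ribbonMatrix_le _ hn hk (fun R h => (properCoeff_support h).1) (by positivity) ?_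
  intro U S hU
  refine (row_sum_le (w := normWeight (properCoeff q τ i) (Real.log n))
    (A := 4 * Real.exp (-(ε * Real.log n / 4))) (by positivity) (Real.exp_pos _).le ?_
    (normWeight_properCoeff_le hl hε hq hτ i) hkτ hU).trans_eq (by ring)
  intro R hR
  refine properCoeff_support (q := q) (i := i) fun h => hR ?_
  rw [normWeight, h, abs_zero, zero_mul]

end Proper

/-! ### The good event -/

section Final

variable {n d : ℕ}

lemma cliqueRatio_eq (hn : 0 < n) (ε : ℝ) :
    cliqueRatio n ε = Real.exp (-((1 / 2 + ε) * Real.log n)) := by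
  have hn' : (0 : ℝ) < n := by exact_mod_cast hn
  rw [cliqueRatio, div_eq_iff hn'.ne', Real.rpow_def_of_pos hn']
  nth_rewrite 3 [← Real.exp_log hn']
  rw [← Real.exp_add]
  congr 1
  ring

lemma posSemidef_diagonal_conj (G : SimpleGraph (Fin n))
    {X : Matrix (SmallSet n d) (SmallSet n d) ℝ} (hX : X.PosSemidef) :
    (Matrix.diagonal (fun S : SmallSet n d => cliqueRoot G S.1) * X *
      Matrix.diagonal (fun S : SmallSet n d => cliqueRoot G S.1)).PosSemidef := by
  have h := hX.mul_mul_conjTranspose_same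
    (Matrix.diagonal (fun S : SmallSet n d => cliqueRoot G S.1))
  rwa [Matrix.diagonal_conjTranspose, star_trivial] at h

/-- If the traces of a high power of the proper parts are small, the matrix inequalities hold. The
maximum in the bound `η` only matters for `d = 0`, where the inequality for `i = 0` still needs a
finite bound. -/
lemma posSemidef_of_trace_le {q η : ℝ} {τ k : ℕ} {G : SimpleGraph (Fin n)} (hτ : d ≤ τ)
    (hk : Even k) (hk0 : k ≠ 0) (hη : η = 1 / (8 * ((max d 1 : ℕ) : ℝ)))
    (h : ∀ i ≤ 2 * d, (ribbonMatrix (d := d) (properCoeff q τ i) G ^ k).trace ≤ η ^ k) :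
    (Q d q τ G 0 - D d G).PosSemidef ∧ ∀ i : ℕ, 1 ≤ i → i ≤ 2 * d →
      (Q d q τ G i + (1 / (8 * (d : ℝ))) • D d G).PosSemidef ∧
      ((1 / (8 * (d : ℝ))) • D d G - Q d q τ G i).PosSemidef := by
  have hη0 : 0 ≤ η := by rw [hη]; positivity
  have hη1 : η ≤ 1 := by
    have : (1 : ℝ) ≤ ((max d 1 : ℕ) : ℝ) := by exact_mod_cast le_max_right d 1
    rw [hη, div_le_one (by positivity)]
    linarith
  constructor
  · have h1 := posSemidef_add_of_trace_pow_le (ribbonMatrix_isHermitian q τ 0 G) hη0 hk hk0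
      (h 0 (Nat.zero_le _))
    have h2 : ((3 - η) • (1 : Matrix (SmallSet n d) (SmallSet n d) ℝ)).PosSemidef :=
      Matrix.PosSemidef.one.smul (by linarith)
    have h3 := posSemidef_diagonal_conj G (h2.add h1)
    have h4 : Q d q τ G 0 - D d G = Matrix.diagonal (fun S : SmallSet n d => cliqueRoot G S.1) *
        ((3 - η) • (1 : Matrix (SmallSet n d) (SmallSet n d) ℝ) +
          (η • (1 : Matrix (SmallSet n d) (SmallSet n d) ℝ) +
            ribbonMatrix (properCoeff q τ 0) G)) *
        Matrix.diagonal (fun S : SmallSet n d => cliqueRoot G S.1) := by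
      rw [Q_eq_diagonal_mul, ribbonMatrix_cleanCoeff_zero q hτ, ← cliqueRoot_mul_self]
      simp only [mul_add, add_mul, mul_sub, sub_mul, mul_smul_comm, smul_mul_assoc, mul_one,
        sub_smul]
      rw [show (4 : ℝ) = 3 + 1 by norm_num, add_smul, one_smul]
      abel
    rw [h4]
    exact h3
  · intro i hi hi2
    have hd : max d 1 = d := max_eq_left (by omega)
    rw [hd] at hη
    rw [← hη, Q_eq_diagonal_mul, ribbonMatrix_cleanCoeff q τ hi, ← cliqueRoot_mul_self]
    have hN := ribbonMatrix_isHermitian (d := d) q τ i G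
    have h1 := posSemidef_diagonal_conj G
      (posSemidef_add_of_trace_pow_le hN hη0 hk hk0 (h i hi2))
    have h2 := posSemidef_diagonal_conj G
      (posSemidef_sub_of_trace_pow_le hN hη0 hk hk0 (h i hi2))
    simp only [mul_add, mul_sub, add_mul, sub_mul, mul_smul_comm, smul_mul_assoc, mul_one] at h1 h2
    refine ⟨?_, h2⟩
    rw [add_comm]
    exact h1

open MeasureTheory in
/-- The failure probability, in terms of the parameters of the trace method. -/
lemma one_sub_le_halfGraph_real {ε η : ℝ} {τ k : ℕ} (hn : 0 < n) (hd : d ≤ τ) (hk : Even k)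
    (hk0 : k ≠ 0) (hε : 0 ≤ ε) (hη : η = 1 / (8 * ((max d 1 : ℕ) : ℝ)))
    (hτ : 30 * Real.log 2 * τ ≤ ε * Real.log n)
    (hkτ : Real.exp (-(ε * Real.log n / 5)) * 2 ^ τ * (k * τ : ℕ) ≤ 1)
    (hητ : 2 * (2 ^ τ * (12 * Real.exp (-(ε * Real.log n / 4)) * 2 ^ τ)) ≤ η) :
    1 - (2 * d + 1 : ℕ) * (3 * Real.exp (2 * Real.log n * τ) * (1 / 2) ^ k) ≤
      (halfGraph n).real {G : SimpleGraph (Fin n) |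
        (Q d (cliqueRatio n ε) τ G 0 - D d G).PosSemidef ∧ ∀ i : ℕ, 1 ≤ i → i ≤ 2 * d →
          (Q d (cliqueRatio n ε) τ G i + (1 / (8 * (d : ℝ))) • D d G).PosSemidef ∧
          ((1 / (8 * (d : ℝ))) • D d G - Q d (cliqueRatio n ε) τ G i).PosSemidef} := by
  set q := cliqueRatio n ε with hq
  have hq' := hq.trans (cliqueRatio_eq hn ε)
  set good := {G : SimpleGraph (Fin n) | (Q d q τ G 0 - D d G).PosSemidef ∧
    ∀ i : ℕ, 1 ≤ i → i ≤ 2 * d → (Q d q τ G i + (1 / (8 * (d : ℝ))) • D d G).PosSemidef ∧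
      ((1 / (8 * (d : ℝ))) • D d G - Q d q τ G i).PosSemidef} with hgood
  set bad : ℕ → Set (SimpleGraph (Fin n)) := fun i =>
    {G | η ^ k < (ribbonMatrix (d := d) (properCoeff q τ i) G ^ k).trace} with hbad
  have hη0 : 0 < η := by rw [hη]; positivity
  have hbad_le : ∀ i, (halfGraph n).real (bad i) ≤
      3 * Real.exp (2 * Real.log n * τ) * (1 / 2) ^ k := by
    intro i
    refine (halfGraph_real_le (fun G => trace_pow_nonneg (ribbonMatrix_isHermitian q τ i G) hk)
      (pow_pos hη0 k)
      (sum_trace_properCoeff_le hn (Nat.pos_of_ne_zero hk0) hε hq' hτ hkτ i)).trans ?_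
    rw [mul_div_assoc, pow_mul', ← mul_pow, ← div_pow]
    refine mul_le_mul_of_nonneg_left (pow_le_pow_left₀ (by positivity) ?_ k) (by positivity)
    rw [div_le_iff₀ hη0]
    linarith
  have hcover : goodᶜ ⊆ ⋃ i ∈ Finset.range (2 * d + 1), bad i := by
    intro G hG
    by_contra hcon
    simp only [Set.mem_iUnion, not_exists, Finset.mem_range] at hcon
    refine hG (posSemidef_of_trace_le hd hk hk0 hη fun i hi => ?_)
    exact not_lt.1 (hcon i (by omega))
  have h1 : (halfGraph n).real goodᶜ ≤
      (2 * d + 1 : ℕ) * (3 * Real.exp (2 * Real.log n * τ) * (1 / 2) ^ k) := by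
    refine (measureReal_mono hcover (measure_ne_top _ _)).trans
      ((measureReal_biUnion_finset_le _ _).trans ?_)
    refine (Finset.sum_le_sum fun i _ => hbad_le i).trans_eq ?_
    rw [Finset.sum_const, Finset.card_range, nsmul_eq_mul]
  have h2 := measureReal_union_le (μ := halfGraph n) good goodᶜ
  rw [Set.union_compl_self, probReal_univ] at h2
  linarith

end Final

/-! ### Choice of the parameters -/

section Numerics

lemma two_pow_le_exp (τ : ℕ) : (2 : ℝ) ^ τ ≤ Real.exp τ := by
  rw [← mul_one (τ : ℝ), Real.exp_nat_mul]
  exact pow_le_pow_left₀ two_pos.le (by linarith [Real.add_one_le_exp (1 : ℝ)]) τ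

end Numerics

end PlantedClique

theorem mainTheorem5 :
    ∃ C : ℝ, 0 < C ∧ ∃ K : ℝ, ∃ n₀ : ℕ, ∀ n : ℕ, n₀ ≤ n →
      ∀ (ε : ℝ) (d τ : ℕ), 0 < ε → ε < 1 / 2 →
        C * Real.log (Real.log n) / Real.log n ≤ ε →
        C * d / ε ≤ τ → (τ : ℝ) ≤ ε / C * Real.log n →
        1 - K / (n : ℝ) ^ (10 * Real.log n) ≤
          (PlantedClique.halfGraph n).real
            {G : SimpleGraph (Fin n) |
              (PlantedClique.Q d (PlantedClique.cliqueRatio n ε) τ G 0 -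
                PlantedClique.D d G).PosSemidef ∧
              ∀ i : ℕ, 1 ≤ i → i ≤ 2 * d →
                (PlantedClique.Q d (PlantedClique.cliqueRatio n ε) τ G i +
                  (1 / (8 * (d : ℝ))) • PlantedClique.D d G).PosSemidef ∧
                ((1 / (8 * (d : ℝ))) • PlantedClique.D d G -
                  PlantedClique.Q d (PlantedClique.cliqueRatio n ε) τ G i).PosSemidef} := by
  -- `n₀` is so large that `log log n ≥ 10`
  refine ⟨100, by norm_num, 1, ⌈Real.exp (Real.exp 10)⌉₊, ?_⟩
  intro n hn ε d τ hε hε2 hlog hd hτ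
  have hn1 : Real.exp (Real.exp 10) ≤ n := Nat.ceil_le.1 hn
  have hn0 : (0 : ℝ) < n := (Real.exp_pos _).trans_le hn1
  have hnpos : 0 < n := by exact_mod_cast hn0
  have hl1 : Real.exp 10 ≤ Real.log n := (Real.le_log_iff_exp_le hn0).2 hn1
  have hl0 : 0 < Real.log n := (Real.exp_pos _).trans_le hl1
  have hm1 : 10 ≤ Real.log (Real.log n) := (Real.le_log_iff_exp_le hl0).2 hl1
  set l := Real.log n with hl
  set m := Real.log l with hm
  have hlm : Real.exp m = l := Real.exp_log hl0
  have hl10 : 11 ≤ l := by linarith [Real.add_one_le_exp (10 : ℝ)]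
  -- the quantity `x = ε log n` dominates all others
  set x := ε * l with hx
  have hmx : 100 * m ≤ x := (div_le_iff₀ hl0).1 hlog
  have hτx : 100 * (τ : ℝ) ≤ x := by
    rw [hx]
    have : ε / 100 * l = ε * l / 100 := by ring
    linarith
  have hxl : x ≤ l / 2 := by
    rw [hx]
    nlinarith
  have hdτ' : (d : ℝ) ≤ τ := by
    have h1 := (div_le_iff₀ hε).1 hd
    have h2 : (τ : ℝ) * ε ≤ τ * 1 := mul_le_mul_of_nonneg_left (by linarith) (Nat.cast_nonneg τ)
    linarith [Nat.cast_nonneg (α := ℝ) d]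
  have hdτ : d ≤ τ := by exact_mod_cast hdτ'
  have hlog2 := Real.log_two_lt_d9
  have hlog2' := Real.log_two_gt_d9
  have hτ0 : (0 : ℝ) ≤ τ := Nat.cast_nonneg τ
  -- The power used in the trace method. Each trace exceeds its bound with probability at most
  -- `3 * n ^ (2 * τ) * 2 ^ (-k)`, where `n ^ (2 * τ)` is at most `exp (l ^ 2 / 100)`; so `k` has to
  -- be larger than `10 * l ^ 2 / log 2` by a margin.
  set k := 2 * ⌈20 * l ^ 2⌉₊ with hk
  have hk1 : 40 * l ^ 2 ≤ k := by
    have := Nat.le_ceil (20 * l ^ 2)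
    rw [hk]; push_cast; linarith
  have hk2 : (k : ℝ) ≤ 42 * l ^ 2 := by
    have := Nat.ceil_lt_add_one (a := 20 * l ^ 2) (by positivity)
    rw [hk]; push_cast
    nlinarith
  have hkτ : ((k * τ : ℕ) : ℝ) ≤ l ^ 3 := by
    push_cast
    calc (k : ℝ) * τ ≤ (42 * l ^ 2) * (l / 200) :=
          mul_le_mul hk2 (by linarith) hτ0 (by positivity)
      _ ≤ l ^ 3 := by nlinarith [pow_pos hl0 3]
  have h2τ := PlantedClique.two_pow_le_exp τ
  refine le_trans ?_ (PlantedClique.one_sub_le_halfGraph_real (k := k) (ε := ε) (τ := τ) hnpos hdτ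
    (even_two_mul _) ?_ hε.le rfl ?_ ?_ ?_)
  · rw [Real.rpow_def_of_pos hn0, ← hl]
    refine sub_le_sub_left ?_ 1
    rw [one_div (Real.exp _), ← Real.exp_neg]
    have h1 : ((2 * d + 1 : ℕ) : ℝ) ≤ Real.exp l := by
      push_cast
      refine le_trans ?_ (Real.exp_le_exp.2 (show 2 * (d : ℝ) ≤ l by linarith))
      exact Real.add_one_le_exp _
    have h2 : (3 : ℝ) ≤ Real.exp 2 := by linarith [Real.add_one_le_exp (2 : ℝ)]
    have h3 : (1 / 2 : ℝ) ^ k ≤ Real.exp (-27 * l ^ 2) := by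
      rw [one_div, inv_pow, ← Real.rpow_natCast, Real.rpow_def_of_pos two_pos, ← Real.exp_neg,
        Real.exp_le_exp]
      nlinarith
    calc _ ≤ Real.exp l * (Real.exp 2 * Real.exp (2 * l * τ) * Real.exp (-27 * l ^ 2)) := by
          gcongr
      _ = Real.exp (l + (2 + 2 * l * τ + -27 * l ^ 2)) := by
          rw [← Real.exp_add, ← Real.exp_add, ← Real.exp_add]
      _ ≤ _ := by
          rw [Real.exp_le_exp]
          nlinarith
  · have : 0 < ⌈20 * l ^ 2⌉₊ := Nat.ceil_pos.2 (by positivity)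
    omega
  · rw [← hl, ← hx]
    nlinarith
  · rw [← hl, ← hx]
    calc _ ≤ Real.exp (-(x / 5)) * Real.exp τ * l ^ 3 := by gcongr
      _ = Real.exp (-(x / 5) + τ + 3 * m) := by
          rw [Real.exp_add, Real.exp_add, ← hlm, ← Real.exp_nat_mul]
          norm_num
      _ ≤ 1 := Real.exp_le_one_iff.2 (by linarith)
  · rw [← hl, ← hx, le_div_iff₀ (by positivity)]
    have h1 : ((max d 1 : ℕ) : ℝ) ≤ Real.exp m := by
      rw [hlm]
      push_cast
      exact max_le (by linarith) (by linarith)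
    have h2 : (192 : ℝ) ≤ Real.exp m := by
      have h3 : Real.exp 10 ≤ Real.exp m := Real.exp_le_exp.2 hm1
      have h4 : (2 : ℝ) ^ 10 ≤ Real.exp (10 : ℕ) := PlantedClique.two_pow_le_exp 10
      norm_num at h4
      linarith
    calc _ = 192 * (2 ^ τ * 2 ^ τ) * Real.exp (-(x / 4)) * ((max d 1 : ℕ) : ℝ) := by ring
      _ ≤ Real.exp m * (Real.exp τ * Real.exp τ) * Real.exp (-(x / 4)) * Real.exp m := by gcongr
      _ = Real.exp (m + (τ + τ) + -(x / 4) + m) := by simp only [Real.exp_add]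
      _ ≤ 1 := Real.exp_le_one_iff.2 (by linarith)
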